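/- Let $P$ be a probability distribution on a measurable space $\mathcal Z$, $\Theta$ a set of model parameters, $\theta_{\mathrm{ref}}$ a reference model (not necessarily in $\Theta$), and $\ell(\theta,z)$ a loss such that $\ell(\theta,\cdot)\in[M_0,M_1]$ for all $\theta\in\Theta$ and for $\theta=\theta_{\mathrm{ref}}$; put $M=M_1-M_0$. Assume that all these losses are measurable in $z$ and that the family $\{\ell(\theta,\cdot):\theta\in\Theta\}$ is pointwise measurable, i.e. has a countable subfamily such that every $\ell(\theta,\cdot)$, $\theta\in\Theta$, is the pointwise limit of a sequence from it. Let $R(\theta)=\mathbb E_{z\sim P}[\ell(\theta,z)]$ and let $\theta_*\in\arg\min_{\theta\in\Theta}R(\theta)$. Let $d_v<\infty$ be the VC dimension of the class $\{\ell(\theta,\cdot)-\ell(\theta_{\mathrm{ref}},\cdot):\theta\in\Theta\}$, i.e. the VC dimension of the set of subgraphs $\{(z,t): t<f(z)\}$ of its members. For $z_1,\dots,z_n$ ($n\ge 1$) drawn i.i.d. from $P$ and $\rho\ge 0$, define the DRRho risk $$F(\theta)=\sup\Big\{\sum_{i=1}^n p_i\big(\ell(\theta,z_i)-\ell(\theta_{\mathrm{ref}},z_i)\big)\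 :\ p_i\ge 0,\ \sum_{i=1}^n p_i=1,\ \frac1n\sum_{i=1}^n\frac{(np_i-1)^2}{2}\le\frac{\rho}{n}\Big\}.$$ There is a universal constant $0<c<\infty$ such that the following holds. Let $\delta>0$ and $C_1=\log\frac1\delta+\log c+d_v\log(16e)+2d_v\log n$. If $C_1 n\ge 32M^2$ and $\rho\ge 9C_1$, then with probability at least $1-\delta$ every minimizer $\tilde\theta_*\in\arg\min_{\theta\in\Theta}F(\theta)$ satisfies $$R(\tilde\theta_*)\ \le\ R(\theta_*)+2\sqrt{\frac{2\rho}{n}\,\mathrm{Var}_{z\sim P}\big(\ell(\theta_*,z)-\ell(\theta_{\mathrm{ref}},z)\big)}+\frac{C_2}{n},\qquad C_2=\Big(\frac{50\rho}{3}+4\Big)M .$$ -/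

import Mathlib

open MeasureTheory ProbabilityTheory Filter Topology

namespace DRRho

noncomputable section

/-- A family `C` of sets shatters the finite set `s` if every subset of `s` is cut out of `s`
by some member of `C`. -/
def Shatters {α : Type*} (C : Set (Set α)) (s : Finset α) : Prop :=
  ∀ t : Finset α, t ⊆ s → ∃ A ∈ C, ∀ x ∈ s, x ∈ A ↔ x ∈ t

/-- The VC dimension of a family of sets: the supremum of the sizes of the shattered finite
sets (infinite when they are unbounded). -/
def vcDim {α : Type*} (C : Set (Set α)) : ℕ∞ :=
  ⨆ (s : Finset α) (_ : Shatters C s), (s.card : ℕ∞)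

/-- The subgraph `{(z, t) : t < f z}` of a real function. -/
def subgraph {Z : Type*} (f : Z → ℝ) : Set (Z × ℝ) := {q | q.2 < f q.1}

/-- The VC dimension of a class of real functions: that of its set of subgraphs. -/
def functionVCDim {Z : Type*} (F : Set (Z → ℝ)) : ℕ∞ := vcDim (subgraph '' F)

/-- The RHO loss `ℓ(θ, z) - ℓ(θ_ref, z)`. -/
def rhoLoss {W Z : Type*} (loss : W → Z → ℝ) (θref θ : W) (z : Z) : ℝ :=
  loss θ z - loss θref z

/-- The class of RHO losses of the models in `Θ`. -/
def rhoClass {W Z : Type*} (loss : W → Z → ℝ) (Θ : Set W) (θref : W) : Set (Z → ℝ) :=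
  rhoLoss loss θref '' Θ

/-- The expected risk `R(θ) = E_{z ∼ P} ℓ(θ, z)`. -/
def risk {W Z : Type*} [MeasurableSpace Z] (P : Measure Z) (loss : W → Z → ℝ) (θ : W) : ℝ :=
  ∫ z, loss θ z ∂P

/-- The `φ`-divergence `(1/n) ∑ φ(n pᵢ)` of a weight vector from the uniform weights. -/
def phiDivergence (φ : ℝ → ℝ) {n : ℕ} (p : Fin n → ℝ) : ℝ :=
  (1 / (n : ℝ)) * ∑ i, φ (p i * n)

/-- The generator of the `χ²`-divergence. -/
def chiSq (t : ℝ) : ℝ := (t - 1) ^ 2 / 2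

/-- The weight vectors in the probability simplex whose `χ²`-divergence from the uniform weights
is at most `ρ / n`. -/
def uncertaintySet (n : ℕ) (ρ : ℝ) : Set (Fin n → ℝ) :=
  {p | p ∈ stdSimplex ℝ (Fin n) ∧ phiDivergence chiSq p ≤ ρ / n}

/-- The DRRho risk of `θ` on the sample `z₁, …, zₙ`. -/
def drrhoRisk {W Z : Type*} (loss : W → Z → ℝ) (θref : W) {n : ℕ} (ρ : ℝ) (z : Fin n → Z)
    (θ : W) : ℝ :=
  sSup ((fun p : Fin n → ℝ => ∑ i, p i * rhoLoss loss θref θ (z i)) '' uncertaintySet n ρ)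

/-- `θ` minimizes `J` over `Θ`. -/
def IsArgmin {W : Type*} (J : W → ℝ) (Θ : Set W) (θ : W) : Prop :=
  θ ∈ Θ ∧ ∀ θ' ∈ Θ, J θ ≤ J θ'

/-- The family of losses of the models in `Θ` is a pointwise measurable class: each loss is
measurable, and each is the pointwise limit of a sequence from one countable subfamily. (For
general uncountable classes of finite VC dimension uniform deviations need not be measurable and
uniform laws of large numbers fail.) -/
def PointwiseMeasurable {W Z : Type*} [MeasurableSpace Z] (loss : W → Z → ℝ) (Θ : Set W) : Prop :=
  (∀ θ ∈ Θ, Measurable (loss θ)) ∧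
  ∃ D ⊆ Θ, D.Countable ∧ ∀ θ ∈ Θ, ∃ u : ℕ → W, (∀ k, u k ∈ D) ∧
    ∀ z, Tendsto (fun k => loss (u k) z) atTop (𝓝 (loss θ z))

/-- `C₁ = log (1/δ) + log c + d log (16 e) + 2 d log n`. -/
def C1 (c δ : ℝ) (d n : ℕ) : ℝ :=
  Real.log (1 / δ) + Real.log c + d * Real.log (16 * Real.exp 1) + 2 * d * Real.log n

/-- `C₂ = (50 ρ / 3 + 4) M`. -/
def C2 (ρ M : ℝ) : ℝ := (50 * ρ / 3 + 4) * M

end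

end DRRho

/-!
Write `f` for the difference of the loss of a model and the reference loss, so that `|f| ≤ M`, let
`t = C₁`, and take `c = e⁶⁰⁰`, which makes `t ≥ 600` when `δ < 1`.

The robust risk of `f` lies between `Pₙ f + √(2 ρ Vₙ f / n) - M ρ / n` and
`Pₙ f + √(2 ρ Vₙ f / n)`, where `Pₙ` is the empirical mean and `Vₙ` the empirical variance
(`sSup_uncertaintySet_bounds`: Cauchy–Schwarz for the upper bound, a linear tilt of the uniform
weights for the lower one). As `ρ ≥ 9 t`, it therefore suffices that
`P f ≤ Pₙ f + √(18 t Vₙ f / n) + 32 M t / n` holds for all `f` of the class at once, and that the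
single function of the optimal model obeys Bernstein's inequality and an upper bound for its
empirical variance (`bernstein`); `excess_le` then gives the result.

The uniform empirical Bernstein inequality (`prob_badSample_le`) comes from symmetrization. Given a
sample on which `f` violates it, Chebyshev's inequality shows that with probability at least one
half a ghost sample has a mean of `f` that is not much below `P f`, up to a deviation measured by
the mean squared difference `D` of `f` between the two samples (`half_le_prob_ghost`). Now
exchange the coordinates of the two samples at random. The difference of the means is subgaussian
with variance proxy `D / n`, where `D` does not change under exchanges. Conversely the empirical
variance of the first sample after the exchange has expectation about `D / 4` or more, and a
multiplicative lower tail bound keeps it above `5 D / 32` up to a term of order `M² t / n`. So the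
violation has conditional probability at most `3 e⁻ᵗ` for one function (`card_bad_mix`), and the
class is reduced to finitely many functions by a uniform cover of radius `2 M / n` on the `2 n`
points. By the Sauer–Shelah lemma, applied to subgraphs on the grid of the `2 n` points and `n`
levels, the cover has at most `(2 n² + 1) ^ d` members (`exists_cover`); this number is what
`d log (16 e) + 2 d log n` in `C₁` pays for.

Measurability is handled by proving the uniform inequality for the countable subfamily and passing
to pointwise limits (`not_badSample_of_tendsto`).
-/

namespace DRRho

/-! ### Traces of a VC class on a finite set -/

/-- A finite set with `m` elements has at most `(m + 1) ^ d` subsets of size at most `d`: each is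
the range of a `d`-tuple of points, with the dummy value `none` filling up the tuple. -/
theorem card_filter_powerset_card_le {α : Type*} (S : Finset α) (d : ℕ) :
    (S.powerset.filter fun s => s.card ≤ d).card ≤ (S.card + 1) ^ d := by
  classical
  let g : (Fin d → Option S) → Finset α := fun h =>
    (Finset.univ.filter fun a : S => ∃ i, h i = some a).map (Function.Embedding.subtype _)
  have hsub : (S.powerset.filter fun s => s.card ≤ d) ⊆ Finset.univ.image g := by
    intro s hs
    simp only [Finset.mem_filter, Finset.mem_powerset] at hs
    obtain ⟨hsS, hsd⟩ := hs
    refine Finset.mem_image.2 ⟨fun i => if h : (i : ℕ) < s.card then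
      some ⟨s.equivFin.symm ⟨i, h⟩, hsS (s.equivFin.symm ⟨i, h⟩).2⟩ else none,
      Finset.mem_univ _, ?_⟩
    ext x
    simp only [g, Finset.mem_map, Finset.mem_filter, Finset.mem_univ, true_and,
      Function.Embedding.subtype_apply, Subtype.exists, exists_and_right, exists_eq_right]
    constructor
    · rintro ⟨hx, i, hi⟩
      split_ifs at hi with h
      have := congrArg Subtype.val (Option.some.inj hi)
      simp only at this
      rw [← this]
      exact (s.equivFin.symm ⟨i, h⟩).2
    · intro hx
      refine ⟨hsS hx, ⟨(s.equivFin ⟨x, hx⟩ : ℕ), lt_of_lt_of_le (s.equivFin ⟨x, hx⟩).2 hsd⟩, ?_⟩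
      simp
  calc _ ≤ (Finset.univ.image g).card := Finset.card_le_card hsub
    _ ≤ (Finset.univ : Finset (Fin d → Option S)).card := Finset.card_image_le
    _ = (S.card + 1) ^ d := by simp

/-- **Sauer–Shelah**, in the polynomial form used for covering numbers. -/
theorem card_le_of_vcDim {α : Type*} {C : Set (Set α)} {d : ℕ}
    (hd : vcDim C ≤ d) (S : Finset α) (𝒜 : Finset (Finset α))
    (h𝒜 : ∀ t ∈ 𝒜, t ⊆ S ∧ ∃ A ∈ C, ∀ x ∈ S, x ∈ A ↔ x ∈ t) :
    𝒜.card ≤ (S.card + 1) ^ d := by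
  classical
  refine (Finset.card_le_card_shatterer 𝒜).trans
    ((Finset.card_le_card ?_).trans (card_filter_powerset_card_le S d))
  intro s hs
  rw [Finset.mem_shatterer] at hs
  obtain ⟨t₀, ht₀, hst₀⟩ := hs.exists_superset
  have hsS : s ⊆ S := hst₀.trans (h𝒜 t₀ ht₀).1
  refine Finset.mem_filter.2 ⟨Finset.mem_powerset.2 hsS, ?_⟩
  have hsh : Shatters C s := by
    intro t hts
    obtain ⟨u, hu, rfl⟩ := hs hts
    obtain ⟨A, hA, hAu⟩ := (h𝒜 u hu).2
    refine ⟨A, hA, fun x hx => ?_⟩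
    rw [hAu x (hsS hx), Finset.mem_inter]
    exact ⟨fun h => ⟨hx, h⟩, fun h => h.2⟩
  have h1 : ((s.card : ℕ) : ℕ∞) ≤ vcDim C :=
    le_iSup₂ (f := fun (s : Finset α) (_ : Shatters C s) => (s.card : ℕ∞)) s hsh
  exact_mod_cast h1.trans hd

/-- A class of functions with values in `[-M, M]` and VC dimension `d` has, on finitely many
points, a uniform cover of radius `2 M / k` whose size is that of the set of traces of its
subgraphs on the points paired with `k` equally spaced levels. -/
theorem exists_cover {Z : Type*} {F : Set (Z → ℝ)} {d : ℕ} (hd : functionVCDim F ≤ d) {M : ℝ}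
    (hM : 0 < M) (hF : ∀ f ∈ F, ∀ z, |f z| ≤ M) {ι : Type*} [Fintype ι] (x : ι → Z)
    {k : ℕ} (hk : 0 < k) :
    ∃ G : Finset (Z → ℝ), (∀ g ∈ G, g ∈ F) ∧ G.card ≤ (Fintype.card ι * k + 1) ^ d ∧
      ∀ f ∈ F, ∃ g ∈ G, ∀ i, |f (x i) - g (x i)| ≤ 2 * M / k := by
  classical
  let lev : ℕ → ℝ := fun j => -M + j * (2 * M / k)
  let S : Finset (Z × ℝ) :=
    (Finset.univ ×ˢ Finset.range k).image fun q : ι × ℕ => (x q.1, lev q.2)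
  have hS : S.card ≤ Fintype.card ι * k := by
    refine Finset.card_image_le.trans ?_
    simp
  let tr : (Z → ℝ) → Finset (Z × ℝ) := fun f => S.filter fun q => q ∈ subgraph f
  let T : Finset (Finset (Z × ℝ)) := S.powerset.filter fun t => ∃ f ∈ F, tr f = t
  have hT : ∀ t ∈ T, ∃ f ∈ F, tr f = t := fun t ht => (Finset.mem_filter.1 ht).2
  choose! r hrF hr using hT
  refine ⟨T.image r, ?_, ?_, ?_⟩
  · intro g hg
    obtain ⟨t, ht, rfl⟩ := Finset.mem_image.1 hg
    exact hrF t ht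
  · refine Finset.card_image_le.trans ((card_le_of_vcDim hd S T ?_).trans ?_)
    · intro t ht
      refine ⟨Finset.mem_powerset.1 (Finset.mem_filter.1 ht).1, subgraph (r t),
        ⟨r t, hrF t ht, rfl⟩, fun q hq => ?_⟩
      conv_rhs => rw [← hr t ht]
      simp [tr, hq]
    · gcongr
  · intro f hf
    have hfT : tr f ∈ T :=
      Finset.mem_filter.2 ⟨Finset.mem_powerset.2 (Finset.filter_subset _ _), f, hf, rfl⟩
    refine ⟨r (tr f), Finset.mem_image_of_mem _ hfT, fun i => ?_⟩
    have hstep : 0 < 2 * M / (k : ℝ) := by positivity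
    -- two functions that differ by more than the level spacing are separated by a level
    have key : ∀ f g : Z → ℝ, f ∈ F → g ∈ F → tr f = tr g →
        g (x i) - f (x i) ≤ 2 * M / k := by
      intro f g hf hg hfg
      by_contra hlt
      push Not at hlt
      have hf' := abs_le.1 (hF f hf (x i))
      have hg' := abs_le.1 (hF g hg (x i))
      let j := ⌈(f (x i) + M) / (2 * M / k)⌉₊
      have hj1 : f (x i) ≤ lev j := by
        have := Nat.le_ceil ((f (x i) + M) / (2 * M / k))
        rw [div_le_iff₀ hstep] at this
        simp only [lev, j]; linarith
      have hj2 : lev j < g (x i) := by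
        have := Nat.ceil_lt_add_one (div_nonneg (by linarith : 0 ≤ f (x i) + M) hstep.le)
        rw [← sub_lt_iff_lt_add, lt_div_iff₀ hstep] at this
        simp only [lev, j]; linarith
      have hj3 : j < k := by
        have h : (j : ℝ) * (2 * M / k) < k * (2 * M / k) := by
          have hkk : (k : ℝ) * (2 * M / k) = 2 * M := by field_simp
          rw [hkk]
          have : lev j < M := hj2.trans_le hg'.2
          simp only [lev] at this; linarith
        exact_mod_cast lt_of_mul_lt_mul_right h hstep.le
      have hq : (x i, lev j) ∈ S :=
        Finset.mem_image.2 ⟨(i, j), by simp [hj3], rfl⟩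
      have hq1 : (x i, lev j) ∈ tr g := Finset.mem_filter.2 ⟨hq, hj2⟩
      rw [← hfg] at hq1
      exact absurd (Finset.mem_filter.1 hq1).2 (not_lt.2 hj1)
    rw [abs_le]
    have h1 := key f _ hf (hrF _ hfT) (hr _ hfT).symm
    have h2 := key _ f (hrF _ hfT) hf (hr _ hfT)
    constructor <;> linarith

/-! ### Empirical means and variances -/

/-- The arithmetic mean of the coordinates of a vector. -/
noncomputable def avg {n : ℕ} (a : Fin n → ℝ) : ℝ := (∑ i, a i) / n

/-- The (biased) empirical variance of the coordinates of a vector. -/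
noncomputable def empVar {n : ℕ} (a : Fin n → ℝ) : ℝ := avg fun i => (a i - avg a) ^ 2

/-- The mean squared difference of two vectors. -/
noncomputable def sqDist {n : ℕ} (a b : Fin n → ℝ) : ℝ := avg fun i => (b i - a i) ^ 2

theorem avg_nonneg {n : ℕ} {a : Fin n → ℝ} (h : ∀ i, 0 ≤ a i) : 0 ≤ avg a :=
  div_nonneg (Finset.sum_nonneg fun i _ => h i) (Nat.cast_nonneg n)

theorem avg_mono {n : ℕ} {a b : Fin n → ℝ} (h : ∀ i, a i ≤ b i) : avg a ≤ avg b :=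
  div_le_div_of_nonneg_right (Finset.sum_le_sum fun i _ => h i) (Nat.cast_nonneg n)

theorem avg_const {n : ℕ} (hn : 1 ≤ n) (x : ℝ) : avg (fun _ : Fin n => x) = x := by
  have : (n : ℝ) ≠ 0 := by positivity
  simp [avg]; field_simp

theorem avg_add {n : ℕ} (a b : Fin n → ℝ) : avg (fun i => a i + b i) = avg a + avg b := by
  simp only [avg, Finset.sum_add_distrib, add_div]

theorem avg_sub {n : ℕ} (a b : Fin n → ℝ) : avg (fun i => a i - b i) = avg a - avg b := by
  simp only [avg, Finset.sum_sub_distrib, sub_div]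

theorem avg_mul_left {n : ℕ} (c : ℝ) (a : Fin n → ℝ) : avg (fun i => c * a i) = c * avg a := by
  simp only [avg, ← Finset.mul_sum, mul_div_assoc]

theorem mul_avg {n : ℕ} (hn : 1 ≤ n) (a : Fin n → ℝ) : n * avg a = ∑ i, a i := by
  have : (n : ℝ) ≠ 0 := by positivity
  simp only [avg]; field_simp

theorem empVar_nonneg {n : ℕ} (a : Fin n → ℝ) : 0 ≤ empVar a := avg_nonneg fun _ => sq_nonneg _

theorem sqDist_nonneg {n : ℕ} (a b : Fin n → ℝ) : 0 ≤ sqDist a b :=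
  avg_nonneg fun _ => sq_nonneg _

theorem abs_avg_le {n : ℕ} (hn : 1 ≤ n) {a : Fin n → ℝ} {M : ℝ} (h : ∀ i, |a i| ≤ M) :
    |avg a| ≤ M := by
  rw [abs_le]
  constructor
  · rw [← avg_const hn (-M)]; exact avg_mono fun i => (abs_le.1 (h i)).1
  · conv_rhs => rw [← avg_const hn M]
    exact avg_mono fun i => (abs_le.1 (h i)).2

theorem avg_sub_sq {n : ℕ} (hn : 1 ≤ n) (a : Fin n → ℝ) (c : ℝ) :
    avg (fun i => (a i - c) ^ 2) = empVar a + (avg a - c) ^ 2 := by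
  have h : ∀ x : ℝ, avg (fun i => (a i - x) ^ 2) =
      avg (fun i => a i ^ 2) - 2 * x * avg a + x ^ 2 := by
    intro x
    conv_rhs => rw [← avg_const hn (x ^ 2), ← avg_mul_left, ← avg_sub, ← avg_add]
    congr 1; ext i; ring
  rw [empVar, h, h]; ring

theorem empVar_le_avg_sub_sq {n : ℕ} (hn : 1 ≤ n) (a : Fin n → ℝ) (c : ℝ) :
    empVar a ≤ avg fun i => (a i - c) ^ 2 := by
  rw [avg_sub_sq hn]; linarith [sq_nonneg (avg a - c)]

/-! ### Random exchanges between a sample and a ghost sample -/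

/-- The vector that takes its `i`-th coordinate from `b` if `σ i` holds and from `a` otherwise. -/
def mix {n : ℕ} {α : Type*} (σ : Fin n → Bool) (a b : Fin n → α) (i : Fin n) : α :=
  if σ i then b i else a i

/-- The Chernoff bound for uniformly distributed `σ`, in terms of numbers of favourable cases. -/
theorem card_chernoff {n : ℕ} (g : Fin n → Bool → ℝ) (v : Fin n → ℝ) (s : ℝ)
    (h : ∀ i, Real.exp (g i true) + Real.exp (g i false) ≤ 2 * Real.exp (v i))
    (p : (Fin n → Bool) → Prop) [DecidablePred p] (hp : ∀ σ, p σ → s ≤ ∑ i, g i (σ i)) :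
    ((Finset.univ.filter p).card : ℝ) ≤ 2 ^ n * Real.exp (∑ i, v i - s) := by
  have h1 : ((Finset.univ.filter p).card : ℝ) * Real.exp s ≤
      ∑ σ : Fin n → Bool, Real.exp (∑ i, g i (σ i)) := by
    rw [← nsmul_eq_mul, ← Finset.sum_const]
    refine (Finset.sum_le_sum fun σ hσ => ?_).trans
      (Finset.sum_le_sum_of_subset_of_nonneg (Finset.filter_subset p _)
        fun _ _ _ => (Real.exp_pos _).le)
    exact Real.exp_le_exp.2 (hp σ (Finset.mem_filter.1 hσ).2)
  have h2 : ∑ σ : Fin n → Bool, Real.exp (∑ i, g i (σ i)) =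
      ∏ i, (Real.exp (g i true) + Real.exp (g i false)) := by
    simp_rw [Real.exp_sum]
    have := Finset.prod_univ_sum (fun _ : Fin n => (Finset.univ : Finset Bool))
      (fun i b => Real.exp (g i b))
    simp only [Fintype.piFinset_univ, Fintype.sum_bool] at this
    exact this.symm
  have h3 : ∏ i, (Real.exp (g i true) + Real.exp (g i false)) ≤
      2 ^ n * Real.exp (∑ i, v i) := by
    rw [Real.exp_sum]
    calc _ ≤ ∏ i, (2 * Real.exp (v i)) :=
          Finset.prod_le_prod (fun _ _ => by positivity) fun i _ => h i
      _ = _ := by rw [Finset.prod_mul_distrib]; simp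
  rw [Real.exp_sub, ← mul_div_assoc, le_div_iff₀ (Real.exp_pos s)]
  exact h1.trans (h2.le.trans h3)

/-- Hoeffding's inequality for signed sums. -/
theorem card_hoeffding {n : ℕ} (d : Fin n → ℝ) {t : ℝ} (ht : 0 ≤ t)
    (p : (Fin n → Bool) → Prop) [DecidablePred p]
    (hp : ∀ σ, p σ → √(2 * t * ∑ i, d i ^ 2) < ∑ i, if σ i then -d i else d i) :
    ((Finset.univ.filter p).card : ℝ) ≤ 2 ^ n * Real.exp (-t) := by
  set S := ∑ i, d i ^ 2 with hS
  have hS0 : 0 ≤ S := Finset.sum_nonneg fun i _ => sq_nonneg _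
  rcases hS0.eq_or_lt with h0 | hpos
  · have hd : ∀ i, d i = 0 := by
      intro i
      have := (Finset.sum_eq_zero_iff_of_nonneg (fun i _ => sq_nonneg (d i))).1
        (hS.symm.trans h0.symm) i (Finset.mem_univ i)
      exact pow_eq_zero_iff (two_ne_zero) |>.1 this
    have : Finset.univ.filter p = ∅ := by
      refine Finset.filter_eq_empty_iff.2 fun σ _ hσ => ?_
      have := hp σ hσ
      rw [← h0] at this
      simp [hd] at this
    rw [this]; simp; positivity
  · set l := √(2 * t / S)
    have hl : l ^ 2 = 2 * t / S := Real.sq_sqrt (by positivity)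
    have hl0 : 0 ≤ l := Real.sqrt_nonneg _
    have hls : l * √(2 * t * S) = 2 * t := by
      rw [← Real.sqrt_mul (by positivity)]
      rw [show 2 * t / S * (2 * t * S) = (2 * t) ^ 2 by field_simp]
      exact Real.sqrt_sq (by positivity)
    refine (card_chernoff (fun i b => l * (if b then -d i else d i))
      (fun i => (l * d i) ^ 2 / 2) (2 * t) ?_ p ?_).trans ?_
    · intro i
      have := Real.cosh_le_exp_half_sq (l * d i)
      rw [Real.cosh_eq] at this
      simp only [if_true, Bool.false_eq_true, if_false, mul_neg]
      linarith
    · intro σ hσ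
      rw [← Finset.mul_sum, ← hls]
      exact mul_le_mul_of_nonneg_left (hp σ hσ).le hl0
    · gcongr
      simp_rw [mul_pow]
      rw [← Finset.sum_div, ← Finset.mul_sum, ← hS, hl]
      apply le_of_eq; field_simp; ring

theorem exp_neg_le_one_sub {u : ℝ} (h0 : 0 ≤ u) (h1 : u ≤ 1 / 2) :
    Real.exp (-u) ≤ 1 - 3 / 4 * u := by
  have h := Real.quadratic_le_exp_of_nonneg h0
  rw [Real.exp_neg, inv_le_iff_one_le_mul₀ (Real.exp_pos u)]
  have h2 : (0 : ℝ) ≤ 1 - 3 / 4 * u := by linarith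
  refine le_trans ?_ (mul_le_mul_of_nonneg_left h h2)
  have : 0 ≤ u * (1 / 4 - u / 4 - 3 * u ^ 2 / 8) := mul_nonneg h0 (by nlinarith)
  nlinarith

/-- A multiplicative lower tail bound for sums of nonnegative bounded terms. -/
theorem card_lower_tail {n : ℕ} (Y : Fin n → Bool → ℝ) {B : ℝ} (hB : 0 < B)
    (h0 : ∀ i b, 0 ≤ Y i b) (h1 : ∀ i b, Y i b ≤ B) {t : ℝ}
    (p : (Fin n → Bool) → Prop) [DecidablePred p]
    (hp : ∀ σ, p σ →
      ∑ i, Y i (σ i) < 3 / 4 * ∑ i, (Y i true + Y i false) / 2 - 2 * B * t) :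
    ((Finset.univ.filter p).card : ℝ) ≤ 2 ^ n * Real.exp (-t) := by
  refine (card_chernoff (fun i b => -(Y i b / (2 * B)))
    (fun i => -(3 / 4 * ((Y i true + Y i false) / 2) / (2 * B)))
    (-((3 / 4 * ∑ i, (Y i true + Y i false) / 2 - 2 * B * t) / (2 * B))) ?_ p ?_).trans ?_
  · intro i
    have hu : ∀ b, Real.exp (-(Y i b / (2 * B))) ≤ 1 - 3 / 4 * (Y i b / (2 * B)) := fun b => by
      refine exp_neg_le_one_sub (div_nonneg (h0 i b) (by positivity)) ?_
      rw [div_le_iff₀ (by positivity)]; linarith [h1 i b]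
    have := Real.add_one_le_exp (-(3 / 4 * ((Y i true + Y i false) / 2) / (2 * B)))
    have h3 := hu true
    have h4 := hu false
    have h5 : 3 / 4 * ((Y i true + Y i false) / 2) / (2 * B) =
      (3 / 4 * (Y i true / (2 * B)) + 3 / 4 * (Y i false / (2 * B))) / 2 := by ring
    rw [h5] at this ⊢
    linarith
  · intro σ hσ
    rw [Finset.sum_neg_distrib, ← Finset.sum_div Finset.univ (fun i => Y i (σ i))]
    exact neg_le_neg (div_le_div_of_nonneg_right (hp σ hσ).le (by positivity))
  · gcongr
    rw [Finset.sum_neg_distrib, ← Finset.sum_div, ← Finset.mul_sum]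
    apply le_of_eq; field_simp; ring

theorem avg_mix_add {n : ℕ} (σ : Fin n → Bool) (a b : Fin n → ℝ) :
    avg (mix σ a b) + avg (mix σ b a) = avg a + avg b := by
  rw [← avg_add, ← avg_add]
  congr 1; ext i
  simp only [mix]; split_ifs <;> ring

theorem sqDist_mix {n : ℕ} (σ : Fin n → Bool) (a b : Fin n → ℝ) :
    sqDist (mix σ a b) (mix σ b a) = sqDist a b := by
  unfold sqDist
  congr 1; ext i
  simp only [mix]; split_ifs <;> ring

/-- The numerical comparison behind `card_bad_mix`; `τ` stands for `t / n` and `κ` for `1 / n`. The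
constant `600` makes `√2 + √(16 / 600) < √2.5`, and `2.5 · 32 / 5 = 16` is the factor obtained. -/
theorem self_bounding_le {D V τ κ M x : ℝ} (hD : 0 ≤ D) (hτ : 0 ≤ τ)
    (hM : 0 < M) (hκ : 600 * κ ≤ τ) (hx : x ^ 2 ≤ 2 * τ * D)
    (hV : 5 / 32 * D - 8 * M ^ 2 * τ ≤ V) (hV0 : 0 ≤ V) :
    x + √(16 * κ * D) ≤ √(16 * τ * V) + 12 * M * τ := by
  have hs0 := Real.sqrt_nonneg (τ * D)
  have hs : √(τ * D) ^ 2 = τ * D := Real.sq_sqrt (by positivity)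
  have h1 : x ≤ 1.4143 * √(τ * D) := by
    refine le_of_abs_le (abs_le_of_sq_le_sq ?_ (by positivity))
    rw [mul_pow, hs]; nlinarith [mul_nonneg hτ hD]
  have h2 : √(16 * κ * D) ≤ 0.164 * √(τ * D) := by
    refine Real.sqrt_le_iff.2 ⟨by positivity, ?_⟩
    rw [mul_pow, hs]; nlinarith [mul_le_mul_of_nonneg_right hκ hD, mul_nonneg hτ hD]
  have hw0 := Real.sqrt_nonneg (16 * τ * V)
  have hw : √(16 * τ * V) ^ 2 = 16 * τ * V := Real.sq_sqrt (by positivity)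
  have h3 : 1.5783 * √(τ * D) ≤ √(16 * τ * V) + 12 * M * τ := by
    refine le_of_abs_le (abs_le_of_sq_le_sq ?_ (by positivity))
    rw [mul_pow, hs]
    have h4 := mul_le_mul_of_nonneg_left hV hτ
    have h5 : 0 ≤ √(16 * τ * V) * (12 * M * τ) := by positivity
    have h6 : 0 ≤ τ * D := by positivity
    have h7 : 0 ≤ M ^ 2 * τ ^ 2 := by positivity
    nlinarith
  linarith

/-- Exchanging coordinates at random, the difference of the two means is rarely much larger than
the deviation allowed by the empirical variance of the first vector. The difference is
conditionally subgaussian with variance proxy `sqDist a b / n`, a quantity invariant under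
exchanges, and that quantity is in turn dominated by the empirical variance after the exchange. -/
theorem card_bad_mix {n : ℕ} (hn : 1 ≤ n) (a b : Fin n → ℝ) {M t : ℝ} (hM : 0 < M)
    (ha : ∀ i, |a i| ≤ M) (hb : ∀ i, |b i| ≤ M) (ht : 600 ≤ t) (htn : 16 * t ≤ n)
    (p : (Fin n → Bool) → Prop) [DecidablePred p]
    (hp : ∀ σ, p σ → √(16 * (t / n) * empVar (mix σ a b)) + 12 * M * (t / n) <
      avg (mix σ b a) - avg (mix σ a b) + √(16 * (1 / n) * sqDist a b)) :
    ((Finset.univ.filter p).card : ℝ) ≤ 2 ^ n * (3 * Real.exp (-t)) := by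
  classical
  have hn0 : (0 : ℝ) < n := by positivity
  set c := (avg a + avg b) / 2 with hc
  have hcM : |c| ≤ M := by
    have h1 := abs_le.1 (abs_avg_le hn ha)
    have h2 := abs_le.1 (abs_avg_le hn hb)
    rw [abs_le]; constructor <;> simp only [hc] <;> linarith
  let Y : Fin n → Bool → ℝ := fun i s => ((if s then b i else a i) - c) ^ 2
  have hY1 : ∀ i s, Y i s ≤ 4 * M ^ 2 := by
    intro i s
    have h : |(if s then b i else a i) - c| ≤ 2 * M := by
      refine (abs_sub _ _).trans ?_
      have : |if s then b i else a i| ≤ M := by split_ifs <;> simp [ha, hb]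
      linarith
    calc Y i s ≤ (2 * M) ^ 2 := sq_le_sq' (by linarith [(abs_le.1 h).1]) (abs_le.1 h).2
      _ = _ := by ring
  let p₁ : (Fin n → Bool) → Prop := fun σ =>
    √(2 * t * ∑ i, (b i - a i) ^ 2) < ∑ i, if σ i then -(b i - a i) else b i - a i
  let p₂ : (Fin n → Bool) → Prop := fun σ =>
    √(2 * t * ∑ i, (-(b i - a i)) ^ 2) < ∑ i, if σ i then - -(b i - a i) else -(b i - a i)
  let p₃ : (Fin n → Bool) → Prop := fun σ =>
    ∑ i, Y i (σ i) < 3 / 4 * ∑ i, (Y i true + Y i false) / 2 - 2 * (4 * M ^ 2) * t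
  have hb₁ := card_hoeffding (fun i => b i - a i) (by linarith : 0 ≤ t) p₁ fun _ h => h
  have hb₂ := card_hoeffding (fun i => -(b i - a i)) (by linarith : 0 ≤ t) p₂ fun _ h => h
  have hb₃ := card_lower_tail Y (by positivity) (fun _ _ => sq_nonneg _) hY1 p₃ fun _ h => h
  have hsub : Finset.univ.filter p ⊆
      Finset.univ.filter p₁ ∪ Finset.univ.filter p₂ ∪ Finset.univ.filter p₃ := by
    intro σ hσ
    have hpσ := hp σ (Finset.mem_filter.1 hσ).2
    by_contra hnot
    simp only [Finset.mem_union, Finset.mem_filter, Finset.mem_univ, true_and, not_or, p₁, p₂, p₃,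
      not_lt] at hnot
    obtain ⟨⟨h1, h2⟩, h3⟩ := hnot
    refine absurd hpσ (not_lt.2 ?_)
    have hD0 := sqDist_nonneg a b
    have hD : ∑ i, (b i - a i) ^ 2 = n * sqDist a b := (mul_avg hn _).symm
    set x := avg (mix σ b a) - avg (mix σ a b) with hx
    have hnx : n * x = ∑ i, if σ i then -(b i - a i) else b i - a i := by
      rw [hx, ← avg_sub, mul_avg hn]
      refine Finset.sum_congr rfl fun i _ => ?_
      simp only [mix]; split_ifs <;> ring
    have hnx' : -(n * x) = ∑ i, if σ i then - -(b i - a i) else -(b i - a i) := by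
      rw [hnx, ← Finset.sum_neg_distrib]
      refine Finset.sum_congr rfl fun i _ => ?_
      split_ifs <;> ring
    rw [← hnx, hD] at h1
    simp only [neg_sq] at h2
    rw [← hnx', hD] at h2
    have hx2 : x ^ 2 ≤ 2 * (t / n) * sqDist a b := by
      have h4 : |n * x| ≤ √(2 * t * (n * sqDist a b)) := abs_le.2 ⟨by linarith, h1⟩
      have h5 := Real.sq_sqrt (by positivity : 0 ≤ 2 * t * (n * sqDist a b))
      have h6 := pow_le_pow_left₀ (abs_nonneg _) h4 2
      rw [sq_abs, h5] at h6
      have h7 : 2 * (t / n) * sqDist a b = 2 * t * (n * sqDist a b) / n ^ 2 := by field_simp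
      rw [h7, le_div_iff₀ (by positivity)]; linarith
    have hxc : avg (mix σ a b) - c = -(x / 2) := by
      have := avg_mix_add σ a b
      simp only [hc, hx]; linarith
    have hYs : ∑ i, Y i (σ i) = n * (empVar (mix σ a b) + (x / 2) ^ 2) := by
      rw [← neg_sq (x / 2), ← hxc, ← avg_sub_sq hn, mul_avg hn]
      rfl
    have hYm : n * sqDist a b / 4 ≤ ∑ i, (Y i true + Y i false) / 2 := by
      rw [← hD, Finset.sum_div]
      refine Finset.sum_le_sum fun i _ => ?_
      simp only [Y, if_true, Bool.false_eq_true, if_false]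
      nlinarith [sq_nonneg (b i - c + (a i - c))]
    have hτ : t / n ≤ 1 / 16 := by rw [div_le_iff₀ hn0]; linarith
    refine self_bounding_le hD0 (by positivity) hM ?_ hx2 ?_ (empVar_nonneg _)
    · rw [mul_one_div]; gcongr
    · have h4 : n * (3 / 16 * sqDist a b - 8 * M ^ 2 * (t / n)) ≤
          n * (empVar (mix σ a b) + (x / 2) ^ 2) := by
        rw [← hYs]
        have : n * (3 / 16 * sqDist a b - 8 * M ^ 2 * (t / n)) =
          3 / 4 * (n * sqDist a b / 4) - 2 * (4 * M ^ 2) * t := by field_simp; ring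
        rw [this]; linarith
      have h5 := le_of_mul_le_mul_left h4 hn0
      nlinarith [mul_le_mul_of_nonneg_right hτ hD0]
  have hcard : ((Finset.univ.filter p).card : ℝ) ≤ (Finset.univ.filter p₁).card +
      (Finset.univ.filter p₂).card + (Finset.univ.filter p₃).card := by
    have := (Finset.card_le_card hsub).trans ((Finset.card_union_le _ _).trans
      (add_le_add_left (Finset.card_union_le _ _) _))
    exact_mod_cast this
  linarith

/-- Transfer of the good behaviour from `a', b'` to uniformly close vectors `a, b`. The larger
factor `18` in front of the empirical variance absorbs the perturbation of the square roots. -/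
theorem good_of_close {n : ℕ} (hn : 1 ≤ n) {a b a' b' : Fin n → ℝ} {M t : ℝ} (hM : 0 < M)
    (ht : 600 ≤ t) (htn : 16 * t ≤ n)
    (ha : ∀ i, |a i - a' i| ≤ 2 * M / n) (hb : ∀ i, |b i - b' i| ≤ 2 * M / n)
    (h : avg b' - avg a' + √(16 * (1 / n) * sqDist a' b') ≤
      √(16 * (t / n) * empVar a') + 12 * M * (t / n)) :
    avg b - avg a + √(8 * (1 / n) * sqDist a b) ≤
      √(18 * (t / n) * empVar a) + 13 * M * (t / n) := by
  have hn0 : (0 : ℝ) < n := by positivity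
  have hn1 : (1 : ℝ) ≤ n := by exact_mod_cast hn
  set e := 2 * M / (n : ℝ) with he
  have he0 : 0 < e := by positivity
  have hτ0 : 0 < t / n := by positivity
  have hτ : t / n ≤ 1 / 16 := by rw [div_le_iff₀ hn0]; linarith
  have hκ0 : (0 : ℝ) < 1 / n := by positivity
  have hκ : 1 / (n : ℝ) ≤ 1 := by rw [div_le_iff₀ hn0]; linarith
  have hA := abs_le.1 (abs_avg_le hn ha)
  have hB := abs_le.1 (abs_avg_le hn hb)
  rw [avg_sub] at hA hB
  have hD : sqDist a b ≤ 2 * sqDist a' b' + 8 * e ^ 2 := by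
    unfold sqDist
    conv_rhs => rw [← avg_const hn (8 * e ^ 2), ← avg_mul_left, ← avg_add]
    refine avg_mono fun i => ?_
    have h1 : ((b i - a i) - (b' i - a' i)) ^ 2 ≤ (2 * e) ^ 2 := by
      have h1 := abs_le.1 (ha i)
      have h2 := abs_le.1 (hb i)
      exact sq_le_sq' (by linarith) (by linarith)
    nlinarith [sq_nonneg ((b i - a i) - 2 * (b' i - a' i))]
  have hV : empVar a' ≤ 9 / 8 * empVar a + 9 * e ^ 2 := by
    refine (empVar_le_avg_sub_sq hn a' (avg a)).trans ?_
    rw [empVar]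
    conv_rhs => rw [← avg_const hn (9 * e ^ 2), ← avg_mul_left, ← avg_add]
    refine avg_mono fun i => ?_
    have h1 : (a i - a' i) ^ 2 ≤ e ^ 2 := by
      have h1 := abs_le.1 (ha i)
      exact sq_le_sq' (by linarith) (by linarith)
    nlinarith [sq_nonneg ((a i - avg a) + 8 * (a i - a' i))]
  have hD0 := sqDist_nonneg a' b'
  have hV0 := empVar_nonneg a
  have h1 : √(8 * (1 / n) * sqDist a b) ≤ √(16 * (1 / n) * sqDist a' b') + 8 * e := by
    refine (Real.sqrt_le_sqrt
      (mul_le_mul_of_nonneg_left hD (by positivity : 0 ≤ 8 * (1 / (n : ℝ))))).trans ?_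
    have hs := Real.sq_sqrt (by positivity : 0 ≤ 16 * (1 / (n : ℝ)) * sqDist a' b')
    have hs0 := Real.sqrt_nonneg (16 * (1 / (n : ℝ)) * sqDist a' b')
    refine Real.sqrt_le_iff.2 ⟨by positivity, ?_⟩
    nlinarith [mul_nonneg hs0 he0.le, mul_le_mul_of_nonneg_right hκ (sq_nonneg e)]
  have h2 : √(16 * (t / n) * empVar a') ≤ √(18 * (t / n) * empVar a) + 3 * e := by
    refine (Real.sqrt_le_sqrt
      (mul_le_mul_of_nonneg_left hV (by positivity : 0 ≤ 16 * (t / (n : ℝ))))).trans ?_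
    have hs := Real.sq_sqrt (by positivity : 0 ≤ 18 * (t / (n : ℝ)) * empVar a)
    have hs0 := Real.sqrt_nonneg (18 * (t / (n : ℝ)) * empVar a)
    refine Real.sqrt_le_iff.2 ⟨by positivity, ?_⟩
    nlinarith [mul_nonneg hs0 he0.le, mul_le_mul_of_nonneg_right hτ (sq_nonneg e)]
  have h3 : 13 * e ≤ M * (t / n) := by
    have : 13 * e = M * (26 / n) := by rw [he]; ring
    rw [this]; gcongr; linarith
  linarith

/-! ### The double sample -/

/-- The event, on a sample `x` and a ghost sample `y`, that the means of `f` differ by more than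
the empirical variance on `x` accounts for. It is what the symmetrization reduces the uniform
deviation inequality to. -/
def BadPair {Z : Type*} (M t : ℝ) {n : ℕ} (f : Z → ℝ) (x y : Fin n → Z) : Prop :=
  √(18 * (t / n) * empVar (fun i => f (x i))) + 13 * M * (t / n) <
    avg (fun i => f (y i)) - avg (fun i => f (x i)) +
      √(8 * (1 / n) * sqDist (fun i => f (x i)) (fun i => f (y i)))

theorem comp_mix {n : ℕ} {α : Type*} (f : α → ℝ) (σ : Fin n → Bool) (x y : Fin n → α) :
    (fun i => f (mix σ x y i)) = mix σ (fun i => f (x i)) (fun i => f (y i)) := by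
  ext i; simp only [mix]; split_ifs <;> rfl

/-- For a fixed double sample, few exchanges are bad for some function of a VC class. -/
theorem card_badPair {Z : Type*} {F : Set (Z → ℝ)} {d : ℕ} (hd : functionVCDim F ≤ d) {M t : ℝ}
    (hM : 0 < M) (hF : ∀ f ∈ F, ∀ z, |f z| ≤ M) {n : ℕ} (hn : 1 ≤ n) (ht : 600 ≤ t)
    (htn : 16 * t ≤ n) (x y : Fin n → Z)
    (p : (Fin n → Bool) → Prop) [DecidablePred p]
    (hp : ∀ σ, p σ → ∃ f ∈ F, BadPair M t f (mix σ x y) (mix σ y x)) :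
    ((Finset.univ.filter p).card : ℝ) ≤
      2 ^ n * ((2 * n * n + 1) ^ d * (3 * Real.exp (-t))) := by
  classical
  obtain ⟨G, hGF, hGc, hG⟩ := exists_cover hd hM hF (Sum.elim x y) (k := n) (by omega)
  let q : (Z → ℝ) → (Fin n → Bool) → Prop := fun g σ =>
    √(16 * (t / n) * empVar (mix σ (fun i => g (x i)) (fun i => g (y i)))) + 12 * M * (t / n) <
      avg (mix σ (fun i => g (y i)) (fun i => g (x i))) -
        avg (mix σ (fun i => g (x i)) (fun i => g (y i))) +
        √(16 * (1 / n) * sqDist (fun i => g (x i)) (fun i => g (y i)))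
  have hsub : Finset.univ.filter p ⊆ G.biUnion fun g => Finset.univ.filter (q g) := by
    intro σ hσ
    obtain ⟨f, hf, hbad⟩ := hp σ (Finset.mem_filter.1 hσ).2
    obtain ⟨g, hg, hfg⟩ := hG f hf
    refine Finset.mem_biUnion.2 ⟨g, hg, Finset.mem_filter.2 ⟨Finset.mem_univ _, ?_⟩⟩
    by_contra hq
    simp only [q, not_lt] at hq
    have hx : ∀ i, |f (x i) - g (x i)| ≤ 2 * M / n := fun i => hfg (Sum.inl i)
    have hy : ∀ i, |f (y i) - g (y i)| ≤ 2 * M / n := fun i => hfg (Sum.inr i)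
    rw [← sqDist_mix σ] at hq
    have := good_of_close hn (a := mix σ (fun i => f (x i)) (fun i => f (y i)))
      (b := mix σ (fun i => f (y i)) (fun i => f (x i))) hM ht htn
      (fun i => by simp only [mix]; split_ifs <;> simp [hx, hy])
      (fun i => by simp only [mix]; split_ifs <;> simp [hx, hy]) hq
    rw [BadPair, comp_mix, comp_mix] at hbad
    exact absurd hbad (not_lt.2 this)
  have h1 : ((Finset.univ.filter p).card : ℝ) ≤ G.card * (2 ^ n * (3 * Real.exp (-t))) := by
    have h2 := (Finset.card_le_card hsub).trans Finset.card_biUnion_le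
    calc ((Finset.univ.filter p).card : ℝ)
        ≤ ∑ g ∈ G, ((Finset.univ.filter (q g)).card : ℝ) := by exact_mod_cast h2
      _ ≤ ∑ g ∈ G, 2 ^ n * (3 * Real.exp (-t)) := by
          refine Finset.sum_le_sum fun g hg => ?_
          exact card_bad_mix hn _ _ hM (fun i => hF g (hGF g hg) _) (fun i => hF g (hGF g hg) _)
            ht htn (q g) fun _ h => h
      _ = _ := by simp
  refine h1.trans ?_
  have h3 : (G.card : ℝ) ≤ (2 * n * n + 1) ^ d := by
    have : Fintype.card (Fin n ⊕ Fin n) = 2 * n := by simp; ring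
    rw [this] at hGc
    exact_mod_cast hGc
  calc _ ≤ (2 * n * n + 1 : ℝ) ^ d * (2 ^ n * (3 * Real.exp (-t))) := by gcongr
    _ = _ := by ring

theorem measurable_avg {β : Type*} [MeasurableSpace β] {n : ℕ} {g : β → Fin n → ℝ}
    (h : ∀ i, Measurable fun w => g w i) : Measurable fun w => avg (g w) :=
  (Finset.measurable_sum _ fun i _ => h i).div_const _

theorem measurable_empVar {β : Type*} [MeasurableSpace β] {n : ℕ} {g : β → Fin n → ℝ}
    (h : ∀ i, Measurable fun w => g w i) : Measurable fun w => empVar (g w) :=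
  measurable_avg (g := fun w i => (g w i - avg (g w)) ^ 2)
    fun i => ((h i).sub (measurable_avg h)).pow_const 2

theorem measurable_sqDist {β : Type*} [MeasurableSpace β] {n : ℕ} {g k : β → Fin n → ℝ}
    (hg : ∀ i, Measurable fun w => g w i) (hk : ∀ i, Measurable fun w => k w i) :
    Measurable fun w => sqDist (g w) (k w) :=
  measurable_avg (g := fun w i => (k w i - g w i) ^ 2) fun i => ((hk i).sub (hg i)).pow_const 2

theorem measurableSet_badPair {Z : Type*} [MeasurableSpace Z] (M t : ℝ) {n : ℕ} {f : Z → ℝ}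
    (hf : Measurable f) :
    MeasurableSet {w : (Fin n → Z) × (Fin n → Z) | BadPair M t f w.1 w.2} := by
  have h1 : ∀ i, Measurable fun w : (Fin n → Z) × (Fin n → Z) => f (w.1 i) := fun i => by fun_prop
  have h2 : ∀ i, Measurable fun w : (Fin n → Z) × (Fin n → Z) => f (w.2 i) := fun i => by fun_prop
  exact measurableSet_lt
    ((((measurable_empVar h1).const_mul _).sqrt).add_const _)
    (((measurable_avg h2).sub (measurable_avg h1)).add
      ((measurable_sqDist h1 h2).const_mul _).sqrt)

/-- Exchanging coordinates of two independent samples preserves their joint law. -/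
theorem measurePreserving_mix {Z : Type*} [MeasurableSpace Z] (P : Measure Z)
    [IsProbabilityMeasure P] {n : ℕ} (σ : Fin n → Bool) :
    MeasurePreserving
      (fun w : (Fin n → Z) × (Fin n → Z) => (mix σ w.1 w.2, mix σ w.2 w.1))
      ((Measure.pi fun _ => P).prod (Measure.pi fun _ => P))
      ((Measure.pi fun _ => P).prod (Measure.pi fun _ => P)) := by
  have he := measurePreserving_arrowProdEquivProdArrow Z Z (Fin n) (fun _ => P) (fun _ => P)
  have hk : MeasurePreserving
      (fun (w : Fin n → Z × Z) i => (if σ i then Prod.swap else id) (w i))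
      (Measure.pi fun _ => P.prod P) (Measure.pi fun _ => P.prod P) := by
    refine measurePreserving_pi _ _ fun i => ?_
    split_ifs
    · exact Measure.measurePreserving_swap
    · exact MeasurePreserving.id _
  have := (he.comp hk).comp (he.symm _)
  convert this using 1
  ext w
  · simp only [Function.comp, MeasurableEquiv.arrowProdEquivProdArrow, mix]
    split_ifs with h <;> simp [Equiv.arrowProdEquivProdArrow, h]
  · simp only [Function.comp, MeasurableEquiv.arrowProdEquivProdArrow, mix]
    split_ifs with h <;> simp [Equiv.arrowProdEquivProdArrow, h]

/-- If, for every point, at most a fraction `B` of the exchanges lands in `T`, then `T` has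
probability at most `B`. -/
theorem prob_le_of_card_mix {Z : Type*} [MeasurableSpace Z] (P : Measure Z)
    [IsProbabilityMeasure P] {n : ℕ} {T : Set ((Fin n → Z) × (Fin n → Z))} (hT : MeasurableSet T)
    {B : ℝ}
    (h : ∀ (x y : Fin n → Z) (p : (Fin n → Bool) → Prop) [DecidablePred p],
      (∀ σ, p σ → (mix σ x y, mix σ y x) ∈ T) → ((Finset.univ.filter p).card : ℝ) ≤ 2 ^ n * B) :
    ((Measure.pi fun _ => P).prod (Measure.pi fun _ => P)) T ≤ ENNReal.ofReal B := by
  classical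
  set Q := ((Measure.pi fun _ : Fin n => P).prod (Measure.pi fun _ : Fin n => P)) with hQ
  have h1 : ∑ _σ : Fin n → Bool, Q T ≤ ENNReal.ofReal (2 ^ n * B) := by
    calc ∑ _σ : Fin n → Bool, Q T
        = ∑ σ : Fin n → Bool, ∫⁻ w, T.indicator 1 (mix σ w.1 w.2, mix σ w.2 w.1) ∂Q := by
          refine Finset.sum_congr rfl fun σ _ => ?_
          have hσ := measurePreserving_mix P σ
          rw [hσ.lintegral_comp (measurable_one.indicator hT), lintegral_indicator_one hT]
      _ = ∫⁻ w, ∑ σ : Fin n → Bool, T.indicator 1 (mix σ w.1 w.2, mix σ w.2 w.1) ∂Q := by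
          rw [lintegral_finsetSum]
          intro σ _
          exact (measurable_one.indicator hT).comp (measurePreserving_mix P σ).measurable
      _ ≤ ∫⁻ _w, ENNReal.ofReal (2 ^ n * B) ∂Q := by
          refine lintegral_mono fun w => ?_
          have h2 := h w.1 w.2 (fun σ => (mix σ w.1 w.2, mix σ w.2 w.1) ∈ T) fun _ h => h
          simp only [Set.indicator_apply, Pi.one_apply, Finset.sum_boole]
          rw [← ENNReal.ofReal_natCast]
          exact ENNReal.ofReal_le_ofReal h2
      _ = _ := by simp
  rw [Finset.sum_const, Finset.card_univ, ENNReal.ofReal_mul (by positivity)] at h1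
  simp only [Fintype.card_pi, Fintype.card_bool, Finset.prod_const, Finset.card_univ,
    Fintype.card_fin, nsmul_eq_mul] at h1
  rw [ENNReal.ofReal_pow (by norm_num)] at h1
  simp only [ENNReal.ofReal_ofNat, Nat.cast_pow, Nat.cast_ofNat] at h1
  exact (ENNReal.mul_le_mul_iff_right (by simp) (by finiteness)).1 h1

/-! ### Tail bounds for independent samples -/

theorem memLp_of_abs_le {Z : Type*} [MeasurableSpace Z] {P : Measure Z} [IsFiniteMeasure P]
    {f : Z → ℝ} (hf : Measurable f) {M : ℝ} (hM : ∀ z, |f z| ≤ M) (p : ENNReal) : MemLp f p P :=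
  MemLp.of_bound hf.aestronglyMeasurable M (Eventually.of_forall hM)

theorem integrable_of_abs_le {Z : Type*} [MeasurableSpace Z] {P : Measure Z} [IsFiniteMeasure P]
    {f : Z → ℝ} (hf : Measurable f) {M : ℝ} (hM : ∀ z, |f z| ≤ M) : Integrable f P :=
  memLp_one_iff_integrable.1 (memLp_of_abs_le hf hM 1)

theorem abs_integral_le {Z : Type*} [MeasurableSpace Z] {P : Measure Z} [IsProbabilityMeasure P]
    {f : Z → ℝ} {M : ℝ} (hM : ∀ z, |f z| ≤ M) : |∫ z, f z ∂P| ≤ M := by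
  have := norm_integral_le_of_norm_le_const (μ := P) (f := f) (C := M)
    (Eventually.of_forall hM)
  simpa using this

/-- Chebyshev's inequality for a sum of functions of the coordinates of a product space. -/
theorem pi_chebyshev {Z : Type*} [MeasurableSpace Z] (P : Measure Z) [IsProbabilityMeasure P]
    {n : ℕ} {g : Fin n → Z → ℝ} (hg : ∀ i, MemLp (g i) 2 P) {s : ℝ} (hs : 0 < s) :
    (Measure.pi fun _ => P) {y | s ≤ |∑ i, g i (y i) - ∑ i, ∫ z, g i z ∂P|} ≤
      ENNReal.ofReal ((∑ i, variance (g i) P) / s ^ 2) := by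
  have hm : ∀ i, MemLp (fun y : Fin n → Z => g i (y i)) 2 (Measure.pi fun _ => P) := fun i =>
    (hg i).comp_measurePreserving (measurePreserving_eval (fun _ : Fin n => P) i)
  have hX : MemLp (∑ i, fun y : Fin n → Z => g i (y i)) 2 (Measure.pi fun _ => P) :=
    memLp_finsetSum' _ fun i _ => hm i
  have h := meas_ge_le_variance_div_sq hX hs
  rw [variance_sum_pi (μ := fun _ => P) hg] at h
  refine le_trans (le_of_eq ?_) h
  congr 1
  ext y
  have hE : ∫ y, (∑ i, fun y : Fin n → Z => g i (y i)) y ∂(Measure.pi fun _ => P) =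
      ∑ i, ∫ z, g i z ∂P := by
    simp only [Finset.sum_apply]
    rw [integral_finsetSum _ fun i _ => (hm i).integrable (by norm_num)]
    exact Finset.sum_congr rfl fun i _ =>
      integral_comp_eval (μ := fun _ : Fin n => P) (hg i).aestronglyMeasurable
  rw [Set.mem_ofPred_eq, Set.mem_ofPred_eq, hE, Finset.sum_apply]

/-- The mean of a ghost sample `y` is, with probability at least one half, not much below the
expectation. The deviation is measured by the squared distance to an arbitrary vector of values:
in expectation this distance dominates the variance. -/
theorem half_le_prob_ghost {Z : Type*} [MeasurableSpace Z] (P : Measure Z)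
    [IsProbabilityMeasure P] {f : Z → ℝ} (hf : Measurable f) {M : ℝ} (hM : 0 < M)
    (hfM : ∀ z, |f z| ≤ M) {n : ℕ} (hn : 1 ≤ n) (a : Fin n → ℝ) (ha : ∀ i, |a i| ≤ M) :
    1 / 2 ≤ (Measure.pi fun _ => P) {y : Fin n → Z | ∫ z, f z ∂P - avg (fun i => f (y i)) ≤
      √(8 * (1 / n) * sqDist a (fun i => f (y i))) + 16 * M / n} := by
  have hn0 : (0 : ℝ) < n := by positivity
  set μ := ∫ z, f z ∂P with hμ
  set v := variance f P with hv
  set G := {y : Fin n → Z | μ - avg (fun i => f (y i)) ≤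
      √(8 * (1 / n) * sqDist a (fun i => f (y i))) + 16 * M / n} with hG
  have hv0 : 0 ≤ v := variance_nonneg _ _
  have hL : MemLp f 2 P := memLp_of_abs_le hf hfM 2
  have hcheb : ∀ s : ℝ, 0 < s → n * v / s ^ 2 ≤ 1 / 4 →
      (Measure.pi fun _ => P) {y : Fin n → Z | s ≤ |∑ i, f (y i) - n * μ|} ≤ 1 / 4 := by
    intro s hs hs'
    have := pi_chebyshev P (n := n) (g := fun _ => f) (fun _ => hL) hs
    simp only [Finset.sum_const, Finset.card_univ, Fintype.card_fin, nsmul_eq_mul] at this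
    refine this.trans ((ENNReal.ofReal_le_ofReal hs').trans (le_of_eq ?_))
    rw [ENNReal.ofReal_div_of_pos (by norm_num)]; simp
  have hdev : ∀ (y : Fin n → Z) (s : ℝ), |∑ i, f (y i) - n * μ| < s →
      μ - avg (fun i => f (y i)) ≤ s / n := by
    intro y s h
    rw [le_div_iff₀ hn0, sub_mul, mul_comm (avg _), mul_avg hn]
    linarith [(abs_lt.1 h).1]
  have hfinish : ∀ E₁ E₂ : Set (Fin n → Z), (Measure.pi fun _ => P) E₁ ≤ 1 / 4 →
      (Measure.pi fun _ => P) E₂ ≤ 1 / 4 → (∀ y, y ∉ E₁ → y ∉ E₂ → y ∈ G) →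
      1 / 2 ≤ (Measure.pi fun _ => P) G := by
    intro E₁ E₂ h₁ h₂ h
    have huniv : (Set.univ : Set (Fin n → Z)) ⊆ G ∪ (E₁ ∪ E₂) := by
      intro y _
      by_cases hy1 : y ∈ E₁
      · exact Or.inr (Or.inl hy1)
      by_cases hy2 : y ∈ E₂
      · exact Or.inr (Or.inr hy2)
      exact Or.inl (h y hy1 hy2)
    have hsum : (1 / 4 : ENNReal) + 1 / 4 = 1 / 2 := by
      rw [show (1 / 4 : ENNReal) = ENNReal.ofReal (1 / 4) by
          rw [ENNReal.ofReal_div_of_pos (by norm_num)]; simp,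
        show (1 / 2 : ENNReal) = ENNReal.ofReal (1 / 2) by
          rw [ENNReal.ofReal_div_of_pos (by norm_num)]; simp,
        ← ENNReal.ofReal_add (by norm_num) (by norm_num)]
      norm_num
    have h1 : (1 : ENNReal) ≤ (Measure.pi fun _ : Fin n => P) G + 1 / 2 := by
      calc (1 : ENNReal) = (Measure.pi fun _ : Fin n => P) Set.univ := measure_univ.symm
        _ ≤ _ := measure_mono huniv
        _ ≤ _ := measure_union_le _ _
        _ ≤ _ := by
          gcongr
          exact (measure_union_le _ _).trans ((add_le_add h₁ h₂).trans hsum.le)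
    have h2 : (1 / 2 : ENNReal) + 1 / 2 ≤ (Measure.pi fun _ : Fin n => P) G + 1 / 2 := by
      rwa [ENNReal.add_halves]
    exact (ENNReal.add_le_add_iff_right (by simp)).1 h2
  by_cases hcase : n * v < 64 * M ^ 2
  · refine hfinish _ ∅ (hcheb (16 * M) (by positivity) ?_) (by simp) fun y hy _ => ?_
    · rw [div_le_iff₀ (by positivity)]; nlinarith
    · have := hdev y _ (not_le.1 hy)
      exact this.trans (le_add_of_nonneg_left (Real.sqrt_nonneg _))
  push Not at hcase
  have hnv : 0 < n * v := lt_of_lt_of_le (by positivity) hcase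
  have hvpos : 0 < v := pos_of_mul_pos_right hnv hn0.le
  let g : Fin n → Z → ℝ := fun i z => (f z - a i) ^ 2
  have hgm : ∀ i, Measurable (g i) := fun i => (hf.sub_const _).pow_const 2
  have hg0 : ∀ i z, 0 ≤ g i z := fun i z => sq_nonneg _
  have hg1 : ∀ i z, g i z ≤ 4 * M ^ 2 := by
    intro i z
    have h1 := abs_le.1 (hfM z)
    have h2 := abs_le.1 (ha i)
    calc g i z ≤ (2 * M) ^ 2 := sq_le_sq' (by linarith) (by linarith)
      _ = _ := by ring
  have hgb : ∀ i z, |g i z| ≤ 4 * M ^ 2 := fun i z => by rw [abs_of_nonneg (hg0 i z)]; exact hg1 i z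
  have hgL : ∀ i, MemLp (g i) 2 P := fun i => memLp_of_abs_le (hgm i) (hgb i) 2
  have hmean : ∀ i, v ≤ ∫ z, g i z ∂P := by
    intro i
    have h1 := variance_le_expectation_sq (μ := P) (X := fun z => f z - a i)
      (hf.sub_const _).aestronglyMeasurable
    rw [variance_sub_const hf.aestronglyMeasurable] at h1
    exact h1
  have hvarg : ∀ i, variance (g i) P ≤ 4 * M ^ 2 * ∫ z, g i z ∂P := by
    intro i
    refine (variance_le_expectation_sq (hgm i).aestronglyMeasurable).trans ?_
    rw [← integral_const_mul]
    refine integral_mono (integrable_of_abs_le (M := (4 * M ^ 2) ^ 2) ((hgm i).pow_const 2) ?_)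
      ((integrable_of_abs_le (hgm i) (hgb i)).const_mul _) ?_
    · intro z
      simp only [Pi.pow_apply, abs_pow]
      exact pow_le_pow_left₀ (abs_nonneg _) (hgb i z) 2
    · intro z
      simp only [Pi.pow_apply]
      rw [sq (g i z)]
      exact mul_le_mul_of_nonneg_right (hg1 i z) (hg0 i z)
  set S := ∑ i, ∫ z, g i z ∂P with hS
  have hSv : n * v ≤ S := by
    have := Finset.sum_le_sum fun i (_ : i ∈ (Finset.univ : Finset (Fin n))) => hmean i
    simpa using this
  have hS0 : 0 < S := hnv.trans_le hSv
  have hE₂ : (Measure.pi fun _ => P) {y : Fin n → Z | S / 2 ≤ |∑ i, g i (y i) - S|} ≤ 1 / 4 := by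
    refine (pi_chebyshev P hgL (by positivity)).trans
      ((ENNReal.ofReal_le_ofReal (?_ : _ ≤ (1 / 4 : ℝ))).trans (le_of_eq ?_))
    · have hvs : ∑ i, variance (g i) P ≤ 4 * M ^ 2 * S := by
        rw [hS, Finset.mul_sum]; exact Finset.sum_le_sum fun i _ => hvarg i
      rw [div_le_iff₀ (by positivity)]
      nlinarith [mul_le_mul_of_nonneg_right (hcase.trans hSv) hS0.le]
    · rw [ENNReal.ofReal_div_of_pos (by norm_num)]; simp
  refine hfinish _ _ (hcheb (2 * √(n * v)) (by positivity) ?_) hE₂ fun y hy1 hy2 => ?_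
  · rw [mul_pow, Real.sq_sqrt hnv.le]
    apply le_of_eq; field_simp; norm_num
  · have h1 := hdev y _ (not_le.1 hy1)
    have h2 : S / 2 < ∑ i, g i (y i) := by
      rw [Set.mem_ofPred_eq, not_le] at hy2
      have := (abs_lt.1 hy2).1
      linarith
    have h3 : ∑ i, g i (y i) = n * sqDist a (fun i => f (y i)) := (mul_avg hn _).symm
    have h4 : n * v ≤ 2 * (n * sqDist a (fun i => f (y i))) := by linarith
    refine h1.trans ((?_ : _ ≤ _).trans (le_add_of_nonneg_right (by positivity)))
    refine Real.le_sqrt_of_sq_le ?_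
    rw [div_pow, mul_pow, Real.sq_sqrt hnv.le, div_le_iff₀ (by positivity)]
    have : 8 * (1 / n) * sqDist a (fun i => f (y i)) * (n : ℝ) ^ 2 =
      4 * (2 * (n * sqDist a (fun i => f (y i)))) := by field_simp; ring
    rw [this]; linarith

/-- The Chernoff bound for sums of identically distributed terms. -/
theorem pi_chernoff {Z : Type*} [MeasurableSpace Z] (P : Measure Z) [IsProbabilityMeasure P]
    {n : ℕ} {g : Z → ℝ} (hg : Measurable g) (hg1 : ∀ z, |g z| ≤ 1) (s : ℝ) :
    (Measure.pi fun _ : Fin n => P) {x | n * (∫ z, g z ∂P + ∫ z, g z ^ 2 ∂P) + s ≤ ∑ i, g (x i)} ≤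
      ENNReal.ofReal (Real.exp (-s)) := by
  set m := ∫ z, g z ∂P + ∫ z, g z ^ 2 ∂P with hm
  have hi : Integrable g P := integrable_of_abs_le hg hg1
  have hi2 : Integrable (fun z => g z ^ 2) P := integrable_of_abs_le (hg.pow_const 2) (M := 1)
    fun z => by rw [abs_pow]; exact pow_le_one₀ (abs_nonneg _) (hg1 z)
  have hexp : ∫ z, Real.exp (g z) ∂P ≤ Real.exp m := by
    have h1 : ∫ z, Real.exp (g z) ∂P ≤ ∫ z, (1 + (g z + g z ^ 2)) ∂P := by
      refine integral_mono ?_ ((integrable_const 1).add (hi.add hi2)) fun z => ?_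
      · refine integrable_of_abs_le hg.exp (M := Real.exp 1) fun z => ?_
        rw [abs_of_pos (Real.exp_pos _)]
        exact Real.exp_le_exp.2 (abs_le.1 (hg1 z)).2
      · have := (abs_le.1 (Real.abs_exp_sub_one_sub_id_le (hg1 z))).2
        simp only
        linarith
    have h2 : ∫ z, (1 + (g z + g z ^ 2)) ∂P = 1 + m := by
      rw [integral_add (f := fun _ => (1 : ℝ)) (g := fun z => g z + g z ^ 2)
        (integrable_const 1) (hi.add hi2), integral_add hi hi2]
      simp [hm]
    linarith [Real.add_one_le_exp m]
  have hmgf : mgf (fun x : Fin n → Z => ∑ i, g (x i)) (Measure.pi fun _ => P) 1 ≤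
      Real.exp (n * m) := by
    simp only [mgf, one_mul, Real.exp_sum]
    rw [integral_fintype_prod_eq_pow (fun z => Real.exp (g z)), Fintype.card_fin, Real.exp_nat_mul]
    exact pow_le_pow_left₀ (integral_nonneg fun z => (Real.exp_pos _).le) hexp n
  have hint : Integrable (fun x : Fin n → Z => Real.exp (1 * ∑ i, g (x i)))
      (Measure.pi fun _ => P) := by
    refine integrable_of_abs_le (M := Real.exp n) ?_ fun x => ?_
    · exact ((Finset.measurable_sum _ fun i _ => hg.comp (measurable_pi_apply i)).const_mul 1).exp
    · rw [abs_of_pos (Real.exp_pos _), one_mul]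
      refine Real.exp_le_exp.2 ?_
      calc ∑ i, g (x i) ≤ ∑ _i : Fin n, (1 : ℝ) :=
            Finset.sum_le_sum fun i _ => (abs_le.1 (hg1 _)).2
        _ = n := by simp
  have h := measure_ge_le_exp_mul_mgf (n * m + s) zero_le_one hint
  have h2 : Real.exp (-1 * (n * m + s)) * Real.exp (n * m) = Real.exp (-s) := by
    rw [← Real.exp_add]; congr 1; ring
  have h3 := h.trans ((mul_le_mul_of_nonneg_left hmgf (Real.exp_pos _).le).trans h2.le)
  rw [measureReal_def] at h3
  exact (ENNReal.le_ofReal_iff_toReal_le (by finiteness) (Real.exp_pos _).le).2 h3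

/-- The upper half of Bernstein's inequality, and an upper bound of the same strength for the
empirical variance: both fail with probability at most `exp (-t)`. -/
theorem bernstein {Z : Type*} [MeasurableSpace Z] (P : Measure Z) [IsProbabilityMeasure P]
    {f : Z → ℝ} (hf : Measurable f) {M : ℝ} (hM : 0 < M) (hfM : ∀ z, |f z| ≤ M) {n : ℕ}
    (hn : 1 ≤ n) {t : ℝ} (ht : 0 < t) :
    (Measure.pi fun _ => P) {x : Fin n → Z |
      ∫ z, f z ∂P + 2 * √(t / n * variance f P) + 2 * M * (t / n) < avg (fun i => f (x i))} ≤
      ENNReal.ofReal (Real.exp (-t)) ∧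
    (Measure.pi fun _ => P) {x : Fin n → Z |
      2 * variance f P + 4 * M ^ 2 * (t / n) < empVar (fun i => f (x i))} ≤
      ENNReal.ofReal (Real.exp (-t)) := by
  have hn0 : (0 : ℝ) < n := by positivity
  set μ := ∫ z, f z ∂P with hμ
  set v := variance f P with hv
  have hv0 : 0 ≤ v := variance_nonneg _ _
  have hτ0 : 0 < t / n := by positivity
  have hμM : |μ| ≤ M := abs_integral_le hfM
  have hi : Integrable f P := integrable_of_abs_le hf hfM
  have hdev : ∀ z, |f z - μ| ≤ 2 * M := fun z => (abs_sub _ _).trans (by linarith [hfM z])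
  have hvint : ∫ z, (f z - μ) ^ 2 ∂P = v := (variance_eq_integral hf.aemeasurable).symm
  constructor
  · -- the Chernoff parameter that is optimal for the variance, capped at the range
    obtain ⟨l, hl0, hl1, hl⟩ : ∃ l : ℝ, 0 < l ∧ l * (2 * M) ≤ 1 ∧
        l * v + t / n / l ≤ 2 * √(t / n * v) + 2 * M * (t / n) := by
      rcases le_or_gt v (4 * M ^ 2 * (t / n)) with h | h
      · refine ⟨1 / (2 * M), by positivity, by field_simp; exact le_refl _, ?_⟩
        have h1 : v ≤ 2 * M * √(t / n * v) := by
          refine le_of_abs_le (abs_le_of_sq_le_sq ?_ (by positivity))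
          rw [mul_pow, Real.sq_sqrt (by positivity)]
          nlinarith
        have h2 : 1 / (2 * M) * v ≤ √(t / n * v) := by
          rw [one_div, inv_mul_le_iff₀ (by positivity)]; exact h1
        have h3 : t / n / (1 / (2 * M)) = 2 * M * (t / n) := by field_simp
        rw [h3]
        linarith [Real.sqrt_nonneg (t / n * v)]
      · have hvpos : 0 < v := lt_trans (by positivity) h
        refine ⟨√(t / n / v), by positivity, ?_, ?_⟩
        · rw [← le_div_iff₀ (by positivity)]
          refine Real.sqrt_le_iff.2 ⟨by positivity, ?_⟩
          rw [div_le_iff₀ hvpos, div_pow, one_pow, mul_pow, div_mul_eq_mul_div, one_mul,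
            le_div_iff₀ (by positivity)]
          linarith
        · have h1 : √(t / n / v) * v = √(t / n * v) := by
            rw [show t / n * v = t / n / v * v ^ 2 by field_simp,
              Real.sqrt_mul (by positivity), Real.sqrt_sq hv0]
          have h2 : t / n / √(t / n / v) = √(t / n * v) := by
            rw [div_eq_iff (by positivity), ← Real.sqrt_mul (by positivity)]
            rw [show t / n * v * (t / n / v) = (t / n) ^ 2 by field_simp]
            exact (Real.sqrt_sq hτ0.le).symm
          rw [h1, h2]
          have : 0 ≤ 2 * M * (t / n) := by positivity
          linarith
    have hb : ∀ z, |l * (f z - μ)| ≤ 1 := fun z => by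
      rw [abs_mul, abs_of_pos hl0]
      exact (mul_le_mul_of_nonneg_left (hdev z) hl0.le).trans hl1
    refine (measure_mono fun x hx => ?_).trans
      (pi_chernoff P (n := n) ((hf.sub_const μ).const_mul l) hb t)
    simp only [Set.mem_ofPred_eq] at hx ⊢
    simp_rw [mul_pow, integral_const_mul, hvint]
    rw [integral_sub hi (integrable_const μ), ← Finset.mul_sum, Finset.sum_sub_distrib,
      ← mul_avg hn (fun i => f (x i))]
    simp only [integral_const, probReal_univ, smul_eq_mul, one_mul, ← hμ, sub_self, mul_zero,
      zero_add, Finset.sum_const, Finset.card_univ, Fintype.card_fin, nsmul_eq_mul]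
    have h1 : l * v + t / n / l ≤ avg (fun i => f (x i)) - μ := by linarith
    have h2 := mul_le_mul_of_nonneg_left h1 (by positivity : 0 ≤ n * l)
    have h3 : n * l * (l * v + t / n / l) = n * (l ^ 2 * v) + t := by field_simp
    rw [h3] at h2
    linarith
  · set g : Z → ℝ := fun z => (f z - μ) ^ 2 / (4 * M ^ 2) with hgdef
    have hgm : Measurable g := ((hf.sub_const μ).pow_const 2).div_const _
    have hg0 : ∀ z, 0 ≤ g z := fun z => by positivity
    have hg1 : ∀ z, g z ≤ 1 := fun z => by
      rw [hgdef, div_le_one (by positivity)]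
      have := abs_le.1 (hdev z)
      calc (f z - μ) ^ 2 ≤ (2 * M) ^ 2 := sq_le_sq' this.1 this.2
        _ = _ := by ring
    have hgb : ∀ z, |g z| ≤ 1 := fun z => by rw [abs_of_nonneg (hg0 z)]; exact hg1 z
    have hgi : ∫ z, g z ∂P = v / (4 * M ^ 2) := by
      simp only [hgdef, integral_div, hvint]
    have hgi2 : ∫ z, g z ^ 2 ∂P ≤ v / (4 * M ^ 2) := by
      rw [← hgi]
      refine integral_mono (integrable_of_abs_le (M := 1) (hgm.pow_const 2) fun z => ?_)
        (integrable_of_abs_le hgm hgb) fun z => ?_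
      · rw [abs_pow]; exact pow_le_one₀ (abs_nonneg _) (hgb z)
      · simp only
        nlinarith [hg0 z, hg1 z]
    refine (measure_mono fun x hx => ?_).trans (pi_chernoff P (n := n) hgm hgb t)
    simp only [Set.mem_ofPred_eq] at hx ⊢
    have h1 := hx.le.trans (empVar_le_avg_sub_sq hn _ μ)
    have h2 : ∑ i, g (x i) = n * avg (fun i => (f (x i) - μ) ^ 2) / (4 * M ^ 2) := by
      rw [mul_avg hn, Finset.sum_div]
    rw [h2, le_div_iff₀ (by positivity), hgi]
    have h3 := mul_le_mul_of_nonneg_left h1 hn0.le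
    have h4 : (n : ℝ) * (2 * v + 4 * M ^ 2 * (t / n)) =
      (n * (v / (4 * M ^ 2) + v / (4 * M ^ 2)) + t) * (4 * M ^ 2) := by field_simp; ring
    rw [h4] at h3
    refine le_trans ?_ h3
    gcongr

/-! ### The uniform empirical Bernstein inequality -/

theorem continuous_avg {n : ℕ} : Continuous (avg : (Fin n → ℝ) → ℝ) := by
  unfold avg; fun_prop

theorem continuous_empVar {n : ℕ} : Continuous (empVar : (Fin n → ℝ) → ℝ) := by
  unfold empVar avg; fun_prop

/-- The event that the mean of `f` on the sample falls short of its expectation by more than the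
empirical Bernstein bound. -/
def BadSample {Z : Type*} [MeasurableSpace Z] (P : Measure Z) (M t : ℝ) {n : ℕ} (f : Z → ℝ)
    (x : Fin n → Z) : Prop :=
  √(18 * (t / n) * empVar (fun i => f (x i))) + 32 * M * (t / n) <
    ∫ z, f z ∂P - avg (fun i => f (x i))

theorem measurableSet_badSample {Z : Type*} [MeasurableSpace Z] (P : Measure Z) (M t : ℝ) {n : ℕ}
    {f : Z → ℝ} (hf : Measurable f) : MeasurableSet {x : Fin n → Z | BadSample P M t f x} := by
  have h : ∀ i, Measurable fun x : Fin n → Z => f (x i) := fun i => by fun_prop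
  exact measurableSet_lt ((((measurable_empVar h).const_mul _).sqrt).add_const _)
    ((measurable_avg h).const_sub _)

/-- **Uniform empirical Bernstein inequality** for countable subfamilies of a VC class. -/
theorem prob_badSample_le {Z : Type*} [MeasurableSpace Z] (P : Measure Z) [IsProbabilityMeasure P]
    {F F₀ : Set (Z → ℝ)} {d : ℕ} (hd : functionVCDim F ≤ d) (hF₀ : F₀ ⊆ F) (hc : F₀.Countable)
    (hm : ∀ f ∈ F₀, Measurable f) {M t : ℝ} (hM : 0 < M) (hF : ∀ f ∈ F, ∀ z, |f z| ≤ M) {n : ℕ}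
    (hn : 1 ≤ n) (ht : 600 ≤ t) :
    (Measure.pi fun _ => P) {x : Fin n → Z | ∃ f ∈ F₀, BadSample P M t f x} ≤
      ENNReal.ofReal ((2 * n * n + 1) ^ d * (6 * Real.exp (-t))) := by
  have hn0 : (0 : ℝ) < n := by positivity
  set Bad := {x : Fin n → Z | ∃ f ∈ F₀, BadSample P M t f x} with hBad
  rcases lt_or_ge (n : ℝ) (16 * t) with hsmall | htn
  · -- for small samples the deviation allowed exceeds the range of the functions
    have : Bad = ∅ := by
      refine Set.eq_empty_of_forall_notMem fun x ⟨f, hf, hb⟩ => ?_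
      have h1 := abs_le.1 (abs_integral_le (P := P) (hF f (hF₀ hf)))
      have h2 := abs_le.1 (abs_avg_le hn fun i => hF f (hF₀ hf) (x i))
      have h3 : 2 * M < 32 * M * (t / n) := by
        rw [← mul_div_assoc, lt_div_iff₀ hn0]; nlinarith
      have h4 := Real.sqrt_nonneg (18 * (t / n) * empVar (fun i => f (x i)))
      rw [BadSample] at hb
      linarith
    rw [this]; simp
  set T := {w : (Fin n → Z) × (Fin n → Z) | ∃ f ∈ F₀, BadPair M t f w.1 w.2} with hT
  have hTm : MeasurableSet T := by
    have : T = ⋃ f ∈ F₀, {w | BadPair M t f w.1 w.2} := by ext w; simp [hT]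
    rw [this]
    exact MeasurableSet.biUnion hc fun f hf => measurableSet_badPair M t (hm f hf)
  have hBm : MeasurableSet Bad := by
    have : Bad = ⋃ f ∈ F₀, {x | BadSample P M t f x} := by ext w; simp [hBad]
    rw [this]
    exact MeasurableSet.biUnion hc fun f hf => measurableSet_badSample P M t (hm f hf)
  have hQ : ((Measure.pi fun _ => P).prod (Measure.pi fun _ => P)) T ≤
      ENNReal.ofReal ((2 * n * n + 1) ^ d * (3 * Real.exp (-t))) := by
    refine prob_le_of_card_mix P hTm fun x y p _ hp => ?_
    refine card_badPair hd hM hF hn ht htn x y p fun σ hσ => ?_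
    obtain ⟨f, hf, hb⟩ := hp σ hσ
    exact ⟨f, hF₀ hf, hb⟩
  have hlow : 1 / 2 * (Measure.pi fun _ => P) Bad ≤
      ((Measure.pi fun _ => P).prod (Measure.pi fun _ => P)) T := by
    rw [Measure.prod_apply hTm, ← lintegral_indicator_const hBm]
    refine lintegral_mono fun x => ?_
    by_cases hx : x ∈ Bad
    · rw [Set.indicator_of_mem hx]
      obtain ⟨f, hf, hb⟩ := hx
      refine (half_le_prob_ghost P (hm f hf) hM (hF f (hF₀ hf)) hn (fun i => f (x i))
        fun i => hF f (hF₀ hf) _).trans (measure_mono fun y hy => ⟨f, hf, ?_⟩)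
      rw [Set.mem_ofPred_eq] at hy
      rw [BadSample] at hb
      rw [BadPair]
      have h1 : 16 * M / n ≤ 19 * M * (t / n) := by
        rw [← mul_div_assoc]
        exact div_le_div_of_nonneg_right (by nlinarith) hn0.le
      simp only
      linarith
    · rw [Set.indicator_of_notMem hx]; exact zero_le
  have h := hlow.trans hQ
  calc (Measure.pi fun _ => P) Bad
      = 2 * (1 / 2 * (Measure.pi fun _ => P) Bad) := by
        rw [← mul_assoc, one_div, ENNReal.mul_inv_cancel (by norm_num) (by norm_num), one_mul]
    _ ≤ 2 * ENNReal.ofReal ((2 * n * n + 1) ^ d * (3 * Real.exp (-t))) := by gcongr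
    _ = ENNReal.ofReal 2 * ENNReal.ofReal ((2 * n * n + 1) ^ d * (3 * Real.exp (-t))) := by simp
    _ = _ := by rw [← ENNReal.ofReal_mul (by norm_num)]; congr 1; ring

/-- The property of not being bad passes to pointwise limits of uniformly bounded functions. -/
theorem not_badSample_of_tendsto {Z : Type*} [MeasurableSpace Z] (P : Measure Z)
    [IsProbabilityMeasure P] {M t : ℝ} {n : ℕ} {f : Z → ℝ} {u : ℕ → Z → ℝ}
    (hu : ∀ k, Measurable (u k)) (huM : ∀ k z, |u k z| ≤ M)
    (hlim : ∀ z, Tendsto (fun k => u k z) atTop (𝓝 (f z))) {x : Fin n → Z}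
    (h : ∀ k, ¬ BadSample P M t (u k) x) : ¬ BadSample P M t f x := by
  simp only [BadSample, not_lt] at h ⊢
  have hx : Tendsto (fun k => fun i => u k (x i)) atTop (𝓝 fun i => f (x i)) :=
    tendsto_pi_nhds.2 fun i => hlim (x i)
  have hE : Tendsto (fun k => ∫ z, u k z ∂P) atTop (𝓝 (∫ z, f z ∂P)) :=
    tendsto_integral_of_dominated_convergence (fun _ => M)
      (fun k => (hu k).aestronglyMeasurable) (integrable_const M)
      (fun k => Eventually.of_forall (huM k)) (Eventually.of_forall hlim)
  exact le_of_tendsto_of_tendsto' (hE.sub ((continuous_avg.tendsto _).comp hx))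
    ((((continuous_empVar.tendsto _).comp hx).const_mul _).sqrt.add_const _) h

/-! ### The robust risk and the empirical variance -/

theorem sum_mul_le_of_mem_uncertaintySet {n : ℕ} (hn : 1 ≤ n) (a : Fin n → ℝ) {ρ : ℝ}
    {p : Fin n → ℝ} (hp : p ∈ uncertaintySet n ρ) :
    ∑ i, p i * a i ≤ avg a + √(2 * (ρ / n) * empVar a) := by
  have hn0 : (0 : ℝ) < n := by positivity
  obtain ⟨⟨-, hp1⟩, hdiv⟩ := hp
  simp only [phiDivergence, chiSq] at hdiv
  have hq : ∑ i, (p i * n - 1) ^ 2 ≤ 2 * ρ := by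
    rw [← Finset.sum_div, one_div, inv_mul_le_iff₀ hn0] at hdiv
    have : (n : ℝ) * (ρ / n) = ρ := by field_simp
    linarith
  have hV : ∑ i, (a i - avg a) ^ 2 = n * empVar a := (mul_avg hn _).symm
  have hsplit : n * (∑ i, p i * a i - avg a) = ∑ i, (p i * n - 1) * (a i - avg a) := by
    have h1 : ∑ i, (p i * n - 1) * (a i - avg a) =
        n * ∑ i, p i * a i - ∑ i, a i - n * avg a * ∑ i, p i + ∑ _i : Fin n, avg a := by
      rw [Finset.mul_sum, Finset.mul_sum, ← Finset.sum_sub_distrib, ← Finset.sum_sub_distrib,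
        ← Finset.sum_add_distrib]
      exact Finset.sum_congr rfl fun i _ => by ring
    rw [h1, hp1, ← mul_avg hn a]
    simp only [Finset.sum_const, Finset.card_univ, Fintype.card_fin, nsmul_eq_mul]
    ring
  have hcs := Finset.sum_mul_sq_le_sq_mul_sq Finset.univ (fun i => p i * n - 1)
    (fun i => a i - avg a)
  rw [← hsplit, hV] at hcs
  have h2 : (∑ i, p i * a i - avg a) ^ 2 ≤ 2 * (ρ / n) * empVar a := by
    have h3 : (n : ℝ) ^ 2 * (∑ i, p i * a i - avg a) ^ 2 ≤
        (n : ℝ) ^ 2 * (2 * (ρ / n) * empVar a) := by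
      have h4 : (n : ℝ) ^ 2 * (2 * (ρ / n) * empVar a) = 2 * ρ * (n * empVar a) := by field_simp
      rw [h4, ← mul_pow]
      exact hcs.trans (mul_le_mul_of_nonneg_right hq (mul_nonneg hn0.le (empVar_nonneg a)))
    exact le_of_mul_le_mul_left h3 (by positivity)
  linarith [Real.le_sqrt_of_sq_le h2]

/-- Tilting the uniform weights along `a` gives an admissible weight vector. -/
theorem exists_mem_uncertaintySet {n : ℕ} (hn : 1 ≤ n) (a : Fin n → ℝ) {M ρ l : ℝ}
    (ha : ∀ i, |a i| ≤ M) (hl0 : 0 ≤ l) (hl1 : l * (2 * M) ≤ 1)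
    (hl : l ^ 2 * empVar a ≤ 2 * (ρ / n)) :
    ∃ p ∈ uncertaintySet n ρ, ∑ i, p i * a i = avg a + l * empVar a := by
  have hn0 : (0 : ℝ) < n := by positivity
  have hcenter : ∑ i, (a i - avg a) = 0 := by
    rw [Finset.sum_sub_distrib, ← mul_avg hn a]; simp
  have hV : ∑ i, (a i - avg a) ^ 2 = n * empVar a := (mul_avg hn _).symm
  refine ⟨fun i => (1 + l * (a i - avg a)) / n, ⟨⟨fun i => ?_, ?_⟩, ?_⟩, ?_⟩
  · have h1 := (abs_le.1 (ha i)).1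
    have h2 := (abs_le.1 (abs_avg_le hn ha)).2
    have : l * (-(2 * M)) ≤ l * (a i - avg a) := mul_le_mul_of_nonneg_left (by linarith) hl0
    exact div_nonneg (by linarith) hn0.le
  · rw [← Finset.sum_div, Finset.sum_add_distrib, ← Finset.mul_sum, hcenter]
    simp only [Finset.sum_const, Finset.card_univ, Fintype.card_fin, nsmul_eq_mul, mul_one,
      mul_zero, add_zero]
    exact div_self hn0.ne'
  · simp only [phiDivergence, chiSq]
    have : ∀ i, ((1 + l * (a i - avg a)) / n * n - 1) ^ 2 / 2 =
        l ^ 2 / 2 * (a i - avg a) ^ 2 := fun i => by field_simp; ring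
    simp_rw [this]
    rw [← Finset.mul_sum, hV]
    have h3 : 1 / (n : ℝ) * (l ^ 2 / 2 * (n * empVar a)) = l ^ 2 * empVar a / 2 := by field_simp
    rw [h3]; linarith
  · have : ∀ i, (1 + l * (a i - avg a)) / n * a i =
        (a i + l * (a i - avg a) ^ 2 + l * avg a * (a i - avg a)) / n := fun i => by ring
    simp_rw [this]
    rw [← Finset.sum_div, Finset.sum_add_distrib, Finset.sum_add_distrib, ← Finset.mul_sum,
      ← Finset.mul_sum, hcenter, hV, ← mul_avg hn a]
    field_simp; ring

/-- The robust risk is the empirical mean plus a multiple of the empirical standard deviation, up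
to a term of order `1 / n`. -/
theorem sSup_uncertaintySet_bounds {n : ℕ} (hn : 1 ≤ n) (a : Fin n → ℝ) {M ρ : ℝ} (hM : 0 < M)
    (ha : ∀ i, |a i| ≤ M) (hρ : 0 ≤ ρ) :
    sSup ((fun p : Fin n → ℝ => ∑ i, p i * a i) '' uncertaintySet n ρ) ≤
      avg a + √(2 * (ρ / n) * empVar a) ∧
    avg a + √(2 * (ρ / n) * empVar a) ≤
      sSup ((fun p : Fin n → ℝ => ∑ i, p i * a i) '' uncertaintySet n ρ) + M * (ρ / n) := by
  have hn0 : (0 : ℝ) < n := by positivity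
  have hr : 0 ≤ ρ / n := by positivity
  have hV0 := empVar_nonneg a
  have hub : ∀ y ∈ (fun p : Fin n → ℝ => ∑ i, p i * a i) '' uncertaintySet n ρ,
      y ≤ avg a + √(2 * (ρ / n) * empVar a) := by
    rintro _ ⟨p, hp, rfl⟩
    exact sum_mul_le_of_mem_uncertaintySet hn a hp
  have hle : ∀ l : ℝ, 0 ≤ l → l * (2 * M) ≤ 1 → l ^ 2 * empVar a ≤ 2 * (ρ / n) →
      avg a + l * empVar a ≤
        sSup ((fun p : Fin n → ℝ => ∑ i, p i * a i) '' uncertaintySet n ρ) := by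
    intro l h0 h1 h2
    obtain ⟨p, hp, hpa⟩ := exists_mem_uncertaintySet hn a ha h0 h1 h2
    rw [← hpa]
    exact le_csSup ⟨_, hub⟩ ⟨p, hp, rfl⟩
  constructor
  · obtain ⟨p, hp, -⟩ := exists_mem_uncertaintySet hn a (l := 0) (ρ := ρ) ha le_rfl (by simp)
      (by simpa using hr)
    exact csSup_le ⟨_, p, hp, rfl⟩ hub
  · -- the tilt is as large as the divergence constraint or the positivity of the weights permits
    rcases le_or_gt (empVar a) (8 * M ^ 2 * (ρ / n)) with h | h
    · have h1 := hle (1 / (2 * M)) (by positivity) (by field_simp; exact le_refl _) (by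
        rw [div_pow, one_pow, mul_pow, div_mul_eq_mul_div, one_mul, div_le_iff₀ (by positivity)]
        linarith)
      have h2 : √(2 * (ρ / n) * empVar a) ≤ 1 / (2 * M) * empVar a + M * (ρ / n) := by
        refine Real.sqrt_le_iff.2 ⟨by positivity, ?_⟩
        have h3 : (1 / (2 * M) * empVar a + M * (ρ / n)) ^ 2 - 2 * (ρ / n) * empVar a =
          (1 / (2 * M) * empVar a - M * (ρ / n)) ^ 2 := by field_simp; ring
        linarith [sq_nonneg (1 / (2 * M) * empVar a - M * (ρ / n))]
      linarith
    · have hV : 0 < empVar a := lt_of_le_of_lt (by positivity) h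
      have h1 := hle (√(2 * (ρ / n) / empVar a)) (Real.sqrt_nonneg _) (by
          rw [← le_div_iff₀ (by positivity)]
          refine Real.sqrt_le_iff.2 ⟨by positivity, ?_⟩
          rw [div_le_iff₀ hV, div_pow, one_pow, mul_pow, div_mul_eq_mul_div, one_mul,
            le_div_iff₀ (by positivity)]
          linarith) (by
          rw [Real.sq_sqrt (by positivity)]; field_simp; exact le_refl _)
      have h2 : √(2 * (ρ / n) / empVar a) * empVar a = √(2 * (ρ / n) * empVar a) := by
        rw [show 2 * (ρ / n) * empVar a = 2 * (ρ / n) / empVar a * empVar a ^ 2 by field_simp,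
          Real.sqrt_mul (by positivity), Real.sqrt_sq hV0]
      have h3 : 0 ≤ M * (ρ / n) := by positivity
      linarith

/-! ### The excess risk of minimizers of the robust risk -/

/-- The chain of inequalities that compares the expectation of `f` with that of the competitor,
with `τ = t / n` and `r = ρ / n`: `E`, `A`, `V`, `F` and `E'`, `A'`, `V'`, `F'` are the
expectation, empirical mean, empirical variance and robust risk of `f` and of the competitor, and
`v` is the true variance of the competitor. -/
theorem excess_le {E A V F E' A' V' F' v M τ r : ℝ} (hM : 0 < M) (hτ : 0 ≤ τ) (hr : 9 * τ ≤ r)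
    (hV : 0 ≤ V) (hv : 0 ≤ v)
    (h1 : E - A ≤ √(18 * τ * V) + 32 * M * τ) (h2 : A + √(2 * r * V) ≤ F + M * r)
    (hF : F ≤ F') (h3 : F' ≤ A' + √(2 * r * V'))
    (h4 : A' ≤ E' + 2 * √(τ * v) + 2 * M * τ) (h5 : V' ≤ 2 * v + 4 * M ^ 2 * τ) :
    E ≤ E' + 2 * √(2 * r * v) + 50 / 3 * M * r := by
  have hr0 : 0 ≤ r := by linarith
  have e1 : √(18 * τ * V) ≤ √(2 * r * V) :=
    Real.sqrt_le_sqrt (mul_le_mul_of_nonneg_right (by linarith) hV)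
  have hs0 := Real.sqrt_nonneg (2 * r * v)
  have hs : √(2 * r * v) ^ 2 = 2 * r * v := Real.sq_sqrt (by positivity)
  have hrv : 9 * (τ * v) ≤ r * v := by nlinarith
  have e2 : √(2 * r * V') ≤ 1.5 * √(2 * r * v) + M * r := by
    refine Real.sqrt_le_iff.2 ⟨by positivity, ?_⟩
    have h6 := mul_le_mul_of_nonneg_left h5 (by positivity : 0 ≤ 2 * r)
    have h7 : 0 ≤ √(2 * r * v) * (M * r) := by positivity
    have h8 : 9 * (M ^ 2 * (r * τ)) ≤ M ^ 2 * (r * r) := by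
      have := mul_le_mul_of_nonneg_left hr (by positivity : 0 ≤ M ^ 2 * r)
      linarith
    have h9 : 0 ≤ r * v := by positivity
    nlinarith
  have e3 : 2 * √(τ * v) ≤ 0.5 * √(2 * r * v) := by
    have : √(τ * v) ≤ 0.25 * √(2 * r * v) := by
      refine Real.sqrt_le_iff.2 ⟨by positivity, ?_⟩
      rw [mul_pow, hs]; nlinarith [mul_nonneg hr0 hv]
    linarith
  have e4 : M * (9 * τ) ≤ M * r := mul_le_mul_of_nonneg_left hr hM.le
  have e5 : 0 ≤ M * r := by positivity
  nlinarith

/-- The confidence parameter `C₁` pays for the union bound over a cover: the factor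
`(16 e n²) ^ d` hidden in `exp C₁` dominates the bound `(2 n² + 1) ^ d` on its size. -/
theorem exp_neg_C1_bound {δ : ℝ} (hδ : 0 < δ) (d : ℕ) {n : ℕ} (hn : 1 ≤ n) :
    (2 * n * n + 1 : ℝ) ^ d * Real.exp (-C1 (Real.exp 600) δ d n) ≤ δ * Real.exp (-600) := by
  have hn1 : (1 : ℝ) ≤ n := by exact_mod_cast hn
  have hn0 : (0 : ℝ) < n := by linarith
  have h16 : (3 : ℝ) ≤ 16 * Real.exp 1 := by linarith [Real.add_one_le_exp 1]
  have hE : Real.exp (-C1 (Real.exp 600) δ d n) =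
      δ * Real.exp (-600) * ((16 * Real.exp 1 * n ^ 2) ^ d)⁻¹ := by
    have h1 : -C1 (Real.exp 600) δ d n =
        Real.log δ + -600 + -(d * Real.log (16 * Real.exp 1 * n ^ 2)) := by
      rw [C1, Real.log_mul (x := 16 * Real.exp 1) (y := (n : ℝ) ^ 2) (by positivity)
        (by positivity), Real.log_pow, Real.log_exp, one_div, Real.log_inv]
      push_cast; ring
    rw [h1, Real.exp_add, Real.exp_add, Real.exp_log hδ, Real.exp_neg (d * _),
      Real.exp_nat_mul, Real.exp_log (by positivity)]
  rw [hE]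
  have h2 : (2 * n * n + 1 : ℝ) ^ d ≤ (16 * Real.exp 1 * n ^ 2) ^ d := by
    refine pow_le_pow_left₀ (by positivity) ?_ d
    nlinarith
  calc _ = (2 * n * n + 1 : ℝ) ^ d * ((16 * Real.exp 1 * n ^ 2) ^ d)⁻¹ *
        (δ * Real.exp (-600)) := by ring
    _ ≤ 1 * (δ * Real.exp (-600)) := by
        gcongr
        rw [← div_eq_mul_inv]
        exact div_le_one_of_le₀ h2 (by positivity)
    _ = _ := one_mul _

theorem le_C1 {δ : ℝ} (hδ : 0 < δ) (hδ1 : δ < 1) (d : ℕ) {n : ℕ} (hn : 1 ≤ n) :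
    600 ≤ C1 (Real.exp 600) δ d n := by
  have hn1 : (1 : ℝ) ≤ n := by exact_mod_cast hn
  have h1 : 0 ≤ Real.log (1 / δ) := Real.log_nonneg (by rw [le_div_iff₀ hδ]; linarith)
  have h2 : 0 ≤ d * Real.log (16 * Real.exp 1) :=
    mul_nonneg (Nat.cast_nonneg d) (Real.log_nonneg (by linarith [Real.add_one_le_exp 1]))
  have h3 : 0 ≤ 2 * d * Real.log n := mul_nonneg (by positivity) (Real.log_nonneg hn1)
  rw [C1, Real.log_exp]
  linarith

/-- The excess risk bound with the space of samples under the product measure as probability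
space, in the nondegenerate case `0 < M`, `δ < 1`. -/
theorem exists_good_samples {W Z : Type*} [MeasurableSpace Z] (P : Measure Z)
    [IsProbabilityMeasure P] {loss : W → Z → ℝ} {Θ : Set W} {θref : W} {M₀ M₁ M : ℝ}
    (hΘ : ∀ θ ∈ Θ, ∀ z, loss θ z ∈ Set.Icc M₀ M₁) (href : ∀ z, loss θref z ∈ Set.Icc M₀ M₁)
    (hMdef : M = M₁ - M₀) (hM : 0 < M) (hpm : PointwiseMeasurable loss Θ)
    (hrefm : Measurable (loss θref)) {d : ℕ} (hd : functionVCDim (rhoClass loss Θ θref) = d)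
    {n : ℕ} {δ ρ : ℝ} (hn : 1 ≤ n) (hδ : 0 < δ) (hδ1 : δ < 1)
    (hρ : 9 * C1 (Real.exp 600) δ d n ≤ ρ) {θstar : W} (hstar : θstar ∈ Θ) :
    ∃ A : Set (Fin n → Z), MeasurableSet A ∧
      ENNReal.ofReal (1 - δ) ≤ (Measure.pi fun _ => P) A ∧
      ∀ x ∈ A, ∀ θ : W, IsArgmin (drrhoRisk loss θref ρ x) Θ θ →
        risk P loss θ ≤ risk P loss θstar
          + 2 * √(2 * ρ / n * variance (rhoLoss loss θref θstar) P) + C2 ρ M / n := by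
  obtain ⟨hmeas, D, hDΘ, hDc, hD⟩ := hpm
  have hn0 : (0 : ℝ) < n := by positivity
  set t := C1 (Real.exp 600) δ d n with ht_def
  have ht : 600 ≤ t := le_C1 hδ hδ1 d hn
  have hfm : ∀ θ ∈ Θ, Measurable (rhoLoss loss θref θ) := fun θ hθ => (hmeas θ hθ).sub hrefm
  have hfM : ∀ θ ∈ Θ, ∀ z, |rhoLoss loss θref θ z| ≤ M := fun θ hθ z => by
    have h1 := hΘ θ hθ z
    have h2 := href z
    rw [abs_le, rhoLoss]
    constructor <;> linarith [h1.1, h1.2, h2.1, h2.2]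
  have hrisk : ∀ θ ∈ Θ, ∫ z, rhoLoss loss θref θ z ∂P = risk P loss θ - risk P loss θref := by
    have hi : ∀ g : Z → ℝ, Measurable g → (∀ z, g z ∈ Set.Icc M₀ M₁) → Integrable g P :=
      fun g hg hb => integrable_of_abs_le hg (M := max |M₀| |M₁|)
        fun z => abs_le_max_abs_abs (hb z).1 (hb z).2
    intro θ hθ
    exact integral_sub (hi _ (hmeas θ hθ) (hΘ θ hθ)) (hi _ hrefm href)
  set F := rhoClass loss Θ θref with hF
  set F₀ := rhoLoss loss θref '' D with hF₀
  have hFM : ∀ f ∈ F, ∀ z, |f z| ≤ M := by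
    rintro _ ⟨θ, hθ, rfl⟩ z
    exact hfM θ hθ z
  have hF₀m : ∀ f ∈ F₀, Measurable f := by
    rintro _ ⟨θ, hθ, rfl⟩
    exact hfm θ (hDΘ hθ)
  set fs := rhoLoss loss θref θstar with hfs
  set B₀ : Set (Fin n → Z) := {x | ∃ f ∈ F₀, BadSample P M t f x} with hB₀
  set B₁ : Set (Fin n → Z) := {x |
    ∫ z, fs z ∂P + 2 * √(t / n * variance fs P) + 2 * M * (t / n) < avg (fun i => fs (x i))}
    with hB₁
  set B₂ : Set (Fin n → Z) := {x |
    2 * variance fs P + 4 * M ^ 2 * (t / n) < empVar (fun i => fs (x i))} with hB₂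
  have hfsm : ∀ i, Measurable fun x : Fin n → Z => fs (x i) := fun i =>
    (hfm θstar hstar).comp (measurable_pi_apply i)
  have hB₀m : MeasurableSet B₀ := by
    have : B₀ = ⋃ f ∈ F₀, {x | BadSample P M t f x} := by ext w; simp [hB₀]
    rw [this]
    exact MeasurableSet.biUnion (hDc.image _) fun f hf => measurableSet_badSample P M t (hF₀m f hf)
  have hB₁m : MeasurableSet B₁ := measurableSet_lt measurable_const (measurable_avg hfsm)
  have hB₂m : MeasurableSet B₂ := measurableSet_lt measurable_const (measurable_empVar hfsm)
  have hprob : (Measure.pi fun _ => P) (B₀ ∪ (B₁ ∪ B₂)) ≤ ENNReal.ofReal δ := by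
    have h0 := prob_badSample_le P hd.le (Set.image_mono hDΘ) (hDc.image _) hF₀m hM hFM hn ht
    obtain ⟨h1, h2⟩ := bernstein P (hfm θstar hstar) hM (hfM θstar hstar) hn
      (by linarith : 0 < t)
    refine (measure_union_le _ _).trans ((add_le_add h0 ((measure_union_le _ _).trans
      (add_le_add h1 h2))).trans ?_)
    rw [← ENNReal.ofReal_add (by positivity) (by positivity),
      ← ENNReal.ofReal_add (by positivity) (by positivity)]
    refine ENNReal.ofReal_le_ofReal ?_
    have h3 := exp_neg_C1_bound hδ d hn
    rw [← ht_def] at h3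
    have h4 : Real.exp (-t) ≤ (2 * n * n + 1 : ℝ) ^ d * Real.exp (-t) :=
      le_mul_of_one_le_left (Real.exp_pos _).le
        (one_le_pow₀ (by nlinarith))
    have h5 : Real.exp (-600) ≤ 1 / 8 := by
      rw [Real.exp_neg, inv_le_comm₀ (Real.exp_pos _) (by norm_num)]
      linarith [Real.add_one_le_exp 600]
    nlinarith
  refine ⟨(B₀ ∪ (B₁ ∪ B₂))ᶜ, (hB₀m.union (hB₁m.union hB₂m)).compl, ?_, ?_⟩
  · rw [prob_compl_eq_one_sub (hB₀m.union (hB₁m.union hB₂m)), ENNReal.ofReal_sub _ hδ.le,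
      ENNReal.ofReal_one]
    exact tsub_le_tsub_left hprob 1
  · intro x hx θ hθ
    simp only [Set.mem_compl_iff, Set.mem_union, not_or] at hx
    obtain ⟨hx0, hx1, hx2⟩ := hx
    have hgood : ¬ BadSample P M t (rhoLoss loss θref θ) x := by
      obtain ⟨u, huD, hu⟩ := hD θ hθ.1
      refine not_badSample_of_tendsto P (u := fun k => rhoLoss loss θref (u k)) (M := M)
        (fun k => hfm _ (hDΘ (huD k))) (fun k => hfM _ (hDΘ (huD k)))
        (fun z => (hu z).sub_const _) fun k hbad => ?_
      exact hx0 ⟨_, ⟨u k, huD k, rfl⟩, hbad⟩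
    rw [BadSample, not_lt] at hgood
    have hρ0 : 0 ≤ ρ := by linarith
    have hlow := (sSup_uncertaintySet_bounds hn (fun i => rhoLoss loss θref θ (x i)) hM
      (fun i => hfM θ hθ.1 _) hρ0).2
    have hup := (sSup_uncertaintySet_bounds hn (fun i => fs (x i)) hM
      (fun i => hfM θstar hstar _) hρ0).1
    have hmin := hθ.2 θstar hstar
    have hmain := excess_le hM (by positivity : 0 ≤ t / n)
      (by rw [← mul_div_assoc]; exact div_le_div_of_nonneg_right hρ hn0.le)
      (empVar_nonneg _) (variance_nonneg fs P) hgood hlow hmin hup (not_lt.1 hx1) (not_lt.1 hx2)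
    rw [hrisk θ hθ.1, hrisk θstar hstar] at hmain
    have h1 : C2 ρ M / n = 50 / 3 * M * (ρ / n) + 4 * M / n := by rw [C2]; ring
    have h2 : 0 ≤ 4 * M / n := by positivity
    rw [h1, show 2 * ρ / n = 2 * (ρ / n) by ring]
    linarith

end DRRho

theorem mainTheorem2 :
    ∃ c : ℝ, 0 < c ∧
      ∀ (W : Type*) (Z : Type*) [MeasurableSpace Z] (P : Measure Z) [IsProbabilityMeasure P]
        (loss : W → Z → ℝ) (Θ : Set W) (θref : W) (M₀ M₁ M : ℝ),
        (∀ θ ∈ Θ, ∀ z, loss θ z ∈ Set.Icc M₀ M₁) →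
        (∀ z, loss θref z ∈ Set.Icc M₀ M₁) →
        M = M₁ - M₀ →
        DRRho.PointwiseMeasurable loss Θ →
        Measurable (loss θref) →
      ∀ d : ℕ, DRRho.functionVCDim (DRRho.rhoClass loss Θ θref) = d →
      ∀ (n : ℕ) (δ ρ : ℝ), 1 ≤ n → 0 < δ →
        32 * M ^ 2 ≤ DRRho.C1 c δ d n * n →
        9 * DRRho.C1 c δ d n ≤ ρ →
      ∀ (Ω : Type*) [MeasurableSpace Ω] (μ : Measure Ω) [IsProbabilityMeasure μ]
        (X : Fin n → Ω → Z), (∀ i, Measurable (X i)) → iIndepFun X μ →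
        (∀ i, μ.map (X i) = P) →
      ∀ θstar : W, DRRho.IsArgmin (DRRho.risk P loss) Θ θstar →
      ∃ A : Set Ω, MeasurableSet A ∧ ENNReal.ofReal (1 - δ) ≤ μ A ∧
        ∀ ω ∈ A, ∀ θtilde : W,
          DRRho.IsArgmin (DRRho.drrhoRisk loss θref ρ (fun i => X i ω)) Θ θtilde →
          DRRho.risk P loss θtilde ≤
            DRRho.risk P loss θstar
              + 2 * Real.sqrt (2 * ρ / n * variance (DRRho.rhoLoss loss θref θstar) P)
              + DRRho.C2 ρ M / n := by
  -- `c` only has to make `C₁` exceed the constant that `card_bad_mix` asks for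
  refine ⟨Real.exp 600, Real.exp_pos _, ?_⟩
  intro W Z _ P _ loss Θ θref M₀ M₁ M hΘ href hMdef hpm hrefm d hd n δ ρ hn hδ _ hρ Ω _ μ _ X hX
    hind hlaw θstar hstar
  rcases le_or_gt 1 δ with hδ1 | hδ1
  · exact ⟨∅, MeasurableSet.empty, by rw [ENNReal.ofReal_of_nonpos (by linarith)]; exact zero_le,
      fun ω hω => absurd hω (Set.notMem_empty ω)⟩
  have ht := DRRho.le_C1 hδ hδ1 d hn
  have hρ0 : 0 ≤ ρ := by linarith
  obtain ⟨z₀⟩ : Nonempty Z := P.nonempty_of_neZero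
  have hM0 : 0 ≤ M := by linarith [(href z₀).1, (href z₀).2]
  rcases hM0.eq_or_lt with hM | hM
  · -- all losses are the same constant
    refine ⟨Set.univ, MeasurableSet.univ, ?_, fun ω _ θ hθ => ?_⟩
    · rw [measure_univ, ENNReal.ofReal_le_one]; linarith
    · have heq : loss θ = loss θstar := by
        ext z
        have h1 := hΘ θ hθ.1 z
        have h2 := hΘ θstar hstar.1 z
        linarith [h1.1, h1.2, h2.1, h2.2]
      have hC : DRRho.C2 ρ M = 0 := by rw [DRRho.C2, ← hM, mul_zero]
      rw [DRRho.risk, DRRho.risk, heq, hC, zero_div, add_zero]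
      exact le_add_of_nonneg_right (by positivity)
  obtain ⟨A, hA, hAp, hAbound⟩ := DRRho.exists_good_samples P hΘ href hMdef hM hpm hrefm hd hn hδ
    hδ1 hρ hstar.1
  have hXm : Measurable fun ω i => X i ω := measurable_pi_iff.2 hX
  refine ⟨(fun ω i => X i ω) ⁻¹' A, hXm hA, ?_, fun ω hω θ hθ => hAbound _ hω θ hθ⟩
  rw [← Measure.map_apply hXm hA, hind.map_fun_eq_pi_map fun i => (hX i).aemeasurable]
  simp_rw [hlaw]
  exact hAp
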